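/- **Folding entropy decomposition.** Let $M\subseteq\mathbb R^d$ be an embedded $C^1$ submanifold (without boundary) of dimension $n$, with $n$-dimensional volume measure $\mathrm{vol}_M$ (the normalized Hausdorff measure on $M$). Let $P$ be a probability measure on $M$ with a density, written $P(x)$, with respect to $\mathrm{vol}_M$. Let $f:M\to\mathbb R^n$ be differentiable, let $J_f(x):T_xM\to\mathbb R^n$ be its Jacobian on the tangent space, and assume that all singular values of $J_f(x)$ are nonzero, i.e. $|J_f(x)J_f(x)^T|:=\det\big(J_f(x)J_f(x)^T\big)>0$, for every $x\in M$. Let $R=f_*P$ be the pushforward of $P$. Write $\langle g\rangle_P\in[-\infty,\infty]$ for the mean of $g$ under $P$, defined when the positive and negative parts of $g$ do not both have infinite integral; let $H_P[x]=-\langle\log P(x)\rangle_{P}$ and $H_R[z]=-\langle\log R(z)\rangle_{R}$ be the differential entropies of $P$ and $R$ with respect to $\mathrm{vol}_M$ and Lebesgue measure; and let $$H_P[x|f(x)]=-\langle \log P(x\,|\,f(x))\rangle_{P(x)}\in[0,\infty]$$ be the folding entropy, where $P(x\,|\,f(x)=z)$ is the mass that the regular conditional distribution of the point given $f=z$ puts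 on $\{x\}$. Then: 1. $R$ has a density $R(z)$ with respect to Lebesgue measure on $\mathbb R^n$. 2. If $H_P[x]$ and $\langle\frac12\log|J_fJ_f^T|\rangle_P$ are defined, and the right-hand side below is not of the indeterminate form $\infty-\infty$, then $H_R[z]$ is defined and $$H_R[z]=H_P[x]+\Big\langle\tfrac12\log|J_f(x)J_f(x)^T|\Big\rangle_{P(x)}-H_P[x|f(x)].$$ 3. $H_P[x|f(x)]=0$ if and only if $f$ is injective outside a $P$-null set. In particular $H_P[x|f(x)]=0$ if $f$ is injective on $M\cap\operatorname{supp}(P)$. 4. If the density of $P$ is positive $\mathrm{vol}_M$-almost everywhere on $M$, then $H_P[x|f(x)]=0$ if and only if $f$ is injective on $M$. -/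

import Mathlib

open MeasureTheory ProbabilityTheory
open scoped ENNReal

noncomputable section

/-- `M ⊆ ℝᵈ` is an embedded `C¹` submanifold of dimension `n` (without boundary): near each of its
points it is the image of an open set of `ℝⁿ` under a `C¹` immersion which is a homeomorphism onto
its image. -/
def IsEmbeddedSubmanifold {d : ℕ} (n : ℕ) (M : Set (EuclideanSpace ℝ (Fin d))) : Prop :=
  ∀ x ∈ M, ∃ (W : Set (EuclideanSpace ℝ (Fin d))) (U : Set (EuclideanSpace ℝ (Fin n)))
    (φ : EuclideanSpace ℝ (Fin n) → EuclideanSpace ℝ (Fin d))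
    (ψ : EuclideanSpace ℝ (Fin d) → EuclideanSpace ℝ (Fin n)),
    IsOpen W ∧ x ∈ W ∧ IsOpen U ∧ ContDiffOn ℝ 1 φ U ∧
    (∀ u ∈ U, Function.Injective (fderiv ℝ φ u)) ∧
    Set.BijOn φ U (M ∩ W) ∧ Set.LeftInvOn ψ φ U ∧ ContinuousOn ψ (M ∩ W)

/-- The `n`-dimensional volume measure of `M ⊆ ℝᵈ`: the `n`-dimensional Hausdorff measure,
normalized to agree with Lebesgue measure on `ℝⁿ`, restricted to `M`. -/
def manifoldVolume {d : ℕ} (n : ℕ) (M : Set (EuclideanSpace ℝ (Fin d))) :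
    Measure (EuclideanSpace ℝ (Fin d)) :=
  (Measure.euclideanHausdorffMeasure n).restrict M

/-- The tangent space of `M ⊆ ℝᵈ` at `x`. -/
def tangentSubspace {d : ℕ} (M : Set (EuclideanSpace ℝ (Fin d))) (x : EuclideanSpace ℝ (Fin d)) :
    Submodule ℝ (EuclideanSpace ℝ (Fin d)) :=
  Submodule.span ℝ (tangentConeAt ℝ M x)

/-- The Jacobian `J_f(x) : T_x M → ℝⁿ` of a map on `M`. Only the values of `f` on `M` matter. -/
def manifoldJacobian {d n : ℕ} (M : Set (EuclideanSpace ℝ (Fin d)))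
    (f : EuclideanSpace ℝ (Fin d) → EuclideanSpace ℝ (Fin n)) (x : EuclideanSpace ℝ (Fin d)) :
    tangentSubspace M x →ₗ[ℝ] EuclideanSpace ℝ (Fin n) :=
  (fderivWithin ℝ f M x).toLinearMap.domRestrict (tangentSubspace M x)

/-- The Jacobian on the tangent space is the restriction of any derivative of `f` within `M`, so
the choice made by `fderivWithin` is immaterial. -/
theorem manifoldJacobian_apply {d n : ℕ} {M : Set (EuclideanSpace ℝ (Fin d))}
    {f : EuclideanSpace ℝ (Fin d) → EuclideanSpace ℝ (Fin n)} {x : EuclideanSpace ℝ (Fin d)}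
    {f' : EuclideanSpace ℝ (Fin d) →L[ℝ] EuclideanSpace ℝ (Fin n)}
    (hf : HasFDerivWithinAt f f' M x) (v : tangentSubspace M x) :
    manifoldJacobian M f x v = f' v := by
  have h : Set.EqOn (fderivWithin ℝ f M x).toLinearMap f'.toLinearMap (tangentConeAt ℝ M x) :=
    hf.differentiableWithinAt.hasFDerivWithinAt.unique_on hf
  exact LinearMap.eqOn_span h v.2

/-- `|J_f(x) J_f(x)ᵀ|`, the transpose being the adjoint for the Euclidean inner products. -/
def jacobianGramDet {d n : ℕ} (M : Set (EuclideanSpace ℝ (Fin d)))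
    (f : EuclideanSpace ℝ (Fin d) → EuclideanSpace ℝ (Fin n)) (x : EuclideanSpace ℝ (Fin d)) : ℝ :=
  LinearMap.det (manifoldJacobian M f x ∘ₗ LinearMap.adjoint (manifoldJacobian M f x))

/-- `m = ⟨g⟩_μ ∈ [-∞, ∞]`: the positive and negative parts of `g` do not both have infinite
integral, and `m` is the difference of these integrals. -/
def HasMean {α : Type*} [MeasurableSpace α] (μ : Measure α) (g : α → EReal) (m : EReal) : Prop :=
  ((∫⁻ x, (g x).toENNReal ∂μ) ≠ ∞ ∨ (∫⁻ x, (-g x).toENNReal ∂μ) ≠ ∞) ∧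
  m = ((∫⁻ x, (g x).toENNReal ∂μ : ℝ≥0∞) : EReal) - ((∫⁻ x, (-g x).toENNReal ∂μ : ℝ≥0∞) : EReal)

/-- `h ∈ [-∞, ∞]` is the differential entropy of `μ` relative to the volume measure `ν`: `μ` has a
density `p` with respect to `ν`, and `h = ⟨-log p⟩_μ`. -/
def HasDifferentialEntropy {α : Type*} [MeasurableSpace α] (μ ν : Measure α) (h : EReal) : Prop :=
  μ ≪ ν ∧ HasMean μ (fun x => -ENNReal.log (μ.rnDeriv ν x)) h

/-- The folding entropy `H_P[x | f(x)] = -⟨log P(x | f(x))⟩_{P(x)} ∈ [0, ∞]`. Here `P(x | f(x))` is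
the mass that the regular conditional distribution under `P` of the point given its image `f(x)`
puts on the point `x`. Since it is at most `1`, the integrand is nonnegative. -/
def foldingEntropy {d n : ℕ} (P : Measure (EuclideanSpace ℝ (Fin d))) [IsProbabilityMeasure P]
    (f : EuclideanSpace ℝ (Fin d) → EuclideanSpace ℝ (Fin n)) : ℝ≥0∞ :=
  ∫⁻ x, (-ENNReal.log (condDistrib id f P (f x) {x})).toENNReal ∂P

end

/-!
# Folding entropy decomposition

The submanifold `M` is covered by countably many measurable pieces on which `f` is injective and
maps the measure `j · vol_M`, where `j = |J_f J_fᵀ|^{1/2}`, to Lebesgue measure on the image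
(`IsAreaPiece`, `IsEmbeddedSubmanifold.exists_countable_isAreaPiece`). To find such pieces inside
the image of a parametrization `φ : U → M`, cover `U` by closed sets on which `f ∘ φ` is close to an
injective linear map. The change of variables formula for `f ∘ φ` on `ℝⁿ` is transported to `M` by
the area formula `vol_M (φ '' A) = ∫_A normDet (Dφ)`
(`euclideanHausdorffMeasure_image_eq_lintegral_normDet`) and the chain rule for volume distortions
(`IsParametrization.abs_det_fderiv_comp`); the latter uses that the tangent space, defined through
the tangent cone, is the range of `Dφ`. The area formula holds because, near a point, `φ` and its
derivative there are bi-Lipschitz equivalent with constant close to `1`.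

The rest is measure theory. Let `p` and `r` be the densities of `P` and of `R = f_* P`. The
conditional distribution given `f = z` is carried by the fibre over `z`, so on a piece `A` the mass
`P(x | f(x))` is the conditional probability of `A` given `f(x)`. Comparing the images under `f` of
two measures on `A` gives `P`-almost everywhere

  `p(x) = P(x | f(x)) · r(f(x)) · j(x)`

(`ae_rnDeriv_eq_condDistrib_singleton_mul`). The entropy decomposition is the mean of the logarithm
of this identity. The folding entropy vanishes exactly when `P(x | f(x)) = 1` almost surely, that is
when almost every conditional distribution is a point mass at the given point, which is injectivity
of `f` on a set of full measure (`ae_condDistrib_singleton_eq_one_iff`).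

Finally, `f` is open along `M` although it need not be continuously differentiable
(`image_mem_nhds_of_injective_fderiv`). If two distinct points of `M` had the same image, the images
of disjoint neighbourhoods would overlap in an open set, and `f` could not become injective by
removing a null set.
-/

/-! ### Means with values in `[-∞, ∞]` -/

theorem HasMean.congr {α : Type*} [MeasurableSpace α] {μ : Measure α} {g g' : α → EReal}
    {m : EReal} (h : HasMean μ g m) (hg : g =ᵐ[μ] g') : HasMean μ g' m := by
  have h1 : ∫⁻ x, (g x).toENNReal ∂μ = ∫⁻ x, (g' x).toENNReal ∂μ :=
    lintegral_congr_ae (hg.mono fun x hx => by simp only [hx])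
  have h2 : ∫⁻ x, (-g x).toENNReal ∂μ = ∫⁻ x, (-g' x).toENNReal ∂μ :=
    lintegral_congr_ae (hg.mono fun x hx => by simp only [hx])
  unfold HasMean at h ⊢
  rwa [← h1, ← h2]

theorem EReal.coe_ennreal_sub_coe_ennreal_ne_top_iff {a b : ℝ≥0∞} (h : a ≠ ∞ ∨ b ≠ ∞) :
    (a : EReal) - b ≠ ⊤ ↔ a ≠ ∞ := by
  induction a <;> induction b <;> simp_all
  rw [EReal.coe_nnreal_eq_coe_real, EReal.coe_nnreal_eq_coe_real, ← EReal.coe_sub]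
  exact EReal.coe_ne_top _

theorem HasMean.neg {α : Type*} [MeasurableSpace α] {μ : Measure α} {g : α → EReal} {m : EReal}
    (h : HasMean μ g m) : HasMean μ (fun x => -g x) (-m) := by
  obtain ⟨h1, rfl⟩ := h
  refine ⟨by simpa using h1.symm, ?_⟩
  rw [EReal.neg_sub]
  · simp [sub_eq_add_neg, add_comm]
  · exact Or.inl (EReal.coe_ennreal_ne_bot _)
  · simpa [EReal.coe_ennreal_eq_top_iff] using h1

theorem HasMean.ne_top_iff {α : Type*} [MeasurableSpace α] {μ : Measure α} {g : α → EReal}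
    {m : EReal} (h : HasMean μ g m) : m ≠ ⊤ ↔ ∫⁻ x, (g x).toENNReal ∂μ ≠ ∞ := by
  obtain ⟨h1, rfl⟩ := h
  exact EReal.coe_ennreal_sub_coe_ennreal_ne_top_iff h1

theorem hasMean_of_nonneg {α : Type*} [MeasurableSpace α] {μ : Measure α} {g : α → EReal}
    (hg : ∀ᵐ x ∂μ, 0 ≤ g x) : HasMean μ g ((∫⁻ x, (g x).toENNReal ∂μ : ℝ≥0∞) : EReal) := by
  have h0 : ∫⁻ x, (-g x).toENNReal ∂μ = 0 := by
    rw [← lintegral_zero (μ := μ)]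
    refine lintegral_congr_ae (hg.mono fun x hx => ?_)
    exact EReal.toENNReal_of_nonpos (by simpa using hx)
  simp [HasMean, h0]

/-- Subtraction in `[-∞, ∞]` undoes an identity of sums in `[0, ∞]` whose terms `a`, `c`, `s`, meant
as integrals of positive parts, are finite; `b`, `d` and `t` may be infinite. -/
theorem ENNReal.coe_sub_coe_eq_of_add_eq {s t a b c d : ℝ≥0∞} (ha : a ≠ ∞) (hc : c ≠ ∞)
    (hs : s ≠ ∞) (h : s + b + d = t + a + c) :
    ((a : EReal) - b) + ((c : EReal) - d) = (s : EReal) - t := by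
  lift a to NNReal using ha
  lift c to NNReal using hc
  lift s to NNReal using hs
  by_cases ht : t = ∞
  · subst ht
    have : b = ∞ ∨ d = ∞ := by
      by_contra! hbd
      have : (s : ℝ≥0∞) + b + d ≠ ∞ := by simp [hbd.1, hbd.2]
      exact this (by rw [h]; simp)
    rcases this with rfl | rfl <;> simp [EReal.sub_top, EReal.bot_add, EReal.add_bot]
  · have hbd : b ≠ ∞ ∧ d ≠ ∞ := by
      have : t + a + c ≠ ∞ := by simp [ht]
      rw [← h] at this
      simpa using this
    lift b to NNReal using hbd.1
    lift d to NNReal using hbd.2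
    lift t to NNReal using ht
    have h' : (s : ℝ) + b + d = t + a + c := by exact_mod_cast h
    have : ((a : ℝ) - b) + ((c : ℝ) - d) = s - t := by linarith
    simp only [EReal.coe_nnreal_eq_coe_real]
    exact_mod_cast congrArg (fun r : ℝ => (r : EReal)) this

/-- Means are additive when both are finite from above. -/
theorem HasMean.add_of_ne_top {α : Type*} [MeasurableSpace α] {μ : Measure α} {u v : α → ℝ}
    {m m' : EReal} (hu : AEMeasurable u μ) (hv : AEMeasurable v μ)
    (h : HasMean μ (fun x => (u x : EReal)) m) (h' : HasMean μ (fun x => (v x : EReal)) m')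
    (hm : m ≠ ⊤) (hm' : m' ≠ ⊤) :
    HasMean μ (fun x => ((u x + v x : ℝ) : EReal)) (m + m') := by
  rw [h.ne_top_iff] at hm
  rw [h'.ne_top_iff] at hm'
  obtain ⟨-, rfl⟩ := h
  obtain ⟨-, rfl⟩ := h'
  simp only [HasMean, ← EReal.coe_neg, EReal.real_coe_toENNReal] at hm hm' ⊢
  have hs : ∫⁻ x, ENNReal.ofReal (u x + v x) ∂μ ≠ ∞ := by
    refine ne_top_of_le_ne_top (ENNReal.add_ne_top.2 ⟨hm, hm'⟩) ?_
    rw [← lintegral_add_left' hu.ennreal_ofReal]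
    exact lintegral_mono fun x => ENNReal.ofReal_add_le
  refine ⟨Or.inl hs, ENNReal.coe_sub_coe_eq_of_add_eq hm hm' hs ?_⟩
  -- integrate `(u + v)⁺ + u⁻ + v⁻ = (u + v)⁻ + u⁺ + v⁺`
  rw [← lintegral_add_left' (by fun_prop), ← lintegral_add_left' (by fun_prop),
    ← lintegral_add_left' (by fun_prop), ← lintegral_add_left' (by fun_prop)]
  refine lintegral_congr fun x => ?_
  simp only [ENNReal.ofReal]
  norm_cast
  ext
  simp only [NNReal.coe_add, Real.coe_toNNReal']
  rcases max_cases (u x) 0 with h1 | h1 <;> rcases max_cases (v x) 0 with h2 | h2 <;>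
  rcases max_cases (-u x) 0 with h3 | h3 <;> rcases max_cases (-v x) 0 with h4 | h4 <;>
  rcases max_cases (u x + v x) 0 with h5 | h5 <;>
  rcases max_cases (-(u x + v x)) 0 with h6 | h6 <;> linarith

theorem HasMean.add {α : Type*} [MeasurableSpace α] {μ : Measure α} {u v : α → ℝ}
    {m m' : EReal} (hu : AEMeasurable u μ) (hv : AEMeasurable v μ)
    (h : HasMean μ (fun x => (u x : EReal)) m) (h' : HasMean μ (fun x => (v x : EReal)) m')
    (hm : (m ≠ ⊤ ∧ m' ≠ ⊤) ∨ (m ≠ ⊥ ∧ m' ≠ ⊥)) :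
    HasMean μ (fun x => ((u x + v x : ℝ) : EReal)) (m + m') := by
  rcases hm with hm | hm
  · exact h.add_of_ne_top hu hv h' hm.1 hm.2
  · have h1 := h.neg
    have h1' := h'.neg
    simp only [← EReal.coe_neg] at h1 h1'
    have h2 := (h1.add_of_ne_top hu.neg hv.neg h1' (by simpa using hm.1) (by simpa using hm.2)).neg
    have e : -(-m + -m') = m + m' := by
      rw [EReal.neg_add (by simp [hm.2]) (by simp [hm.1])]
      simp [sub_eq_add_neg]
    rw [e] at h2
    refine h2.congr (Filter.Eventually.of_forall fun x => ?_)
    simp only [← EReal.coe_neg]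
    congr 1
    simp only [Pi.neg_apply]
    ring

theorem hasMean_map_iff {α β : Type*} [MeasurableSpace α] [MeasurableSpace β] {μ : Measure α}
    {f : α → β} {g : β → EReal} {m : EReal} (hf : AEMeasurable f μ) (hg : Measurable g) :
    HasMean (μ.map f) g m ↔ HasMean μ (fun x => g (f x)) m := by
  unfold HasMean
  rw [lintegral_map' (by fun_prop) hf, lintegral_map' (by fun_prop) hf]

/-! ### Pieces on which the change of variables formula holds -/

/-- `A` is a measurable set on which `f` is injective and which `f` maps onto its image with volume
distortion `j ∈ (0, ∞)`: the image of `j ν` on `A` is the restriction of `lam` to `f '' A`. -/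
structure IsAreaPiece {X Y : Type*} [MeasurableSpace X] [MeasurableSpace Y] (ν : Measure X)
    (lam : Measure Y) (f : X → Y) (j : X → ℝ≥0∞) (A : Set X) : Prop where
  measurableSet : MeasurableSet A
  injOn : Set.InjOn f A
  aemeasurable : AEMeasurable j (ν.restrict A)
  ne_zero : ∀ x ∈ A, j x ≠ 0
  ne_top : ∀ x ∈ A, j x ≠ ∞
  map_eq : ((ν.restrict A).withDensity j).map f = lam.restrict (f '' A)

theorem IsAreaPiece.congr {X Y : Type*} [MeasurableSpace X] [MeasurableSpace Y] {ν : Measure X}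
    {lam : Measure Y} {f g : X → Y} {j : X → ℝ≥0∞} {A : Set X} (h : IsAreaPiece ν lam f j A)
    (hfg : Set.EqOn f g A) : IsAreaPiece ν lam g j A where
  measurableSet := h.measurableSet
  injOn := h.injOn.congr hfg
  aemeasurable := h.aemeasurable
  ne_zero := h.ne_zero
  ne_top := h.ne_top
  map_eq := by
    rw [← hfg.image_eq, ← h.map_eq]
    refine (Measure.map_congr ?_).symm
    exact (withDensity_absolutelyContinuous _ _).ae_eq
      (ae_restrict_of_forall_mem h.measurableSet hfg)

theorem map_withDensity_comp {X Y : Type*} [MeasurableSpace X] [MeasurableSpace Y]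
    {μ : Measure X} {f : X → Y} (hf : AEMeasurable f μ) {h : Y → ℝ≥0∞}
    (hh : AEMeasurable h (μ.map f)) :
    (μ.withDensity (fun x => h (f x))).map f = (μ.map f).withDensity h := by
  ext s hs
  have hf' : AEMeasurable f (μ.withDensity fun x => h (f x)) :=
    hf.mono_ac (withDensity_absolutelyContinuous _ _)
  rw [Measure.map_apply_of_aemeasurable hf' hs, withDensity_apply _ hs,
    withDensity_apply₀ _ (hf.nullMeasurableSet_preimage hs), ← lintegral_indicator hs,
    lintegral_map' (hh.indicator hs) hf,
    ← lintegral_indicator₀ (hf.nullMeasurableSet_preimage hs)]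
  rfl

/-- Two measures carried by a set on which `f` is injective agree if their images under `f` do. -/
theorem measure_eq_of_map_eq_of_injOn {X Y : Type*} [MeasurableSpace X] [StandardBorelSpace X]
    [MeasurableSpace Y] [MeasurableSpace.CountablySeparated Y] {f : X → Y} (hf : Measurable f)
    {A : Set X} (hA : MeasurableSet A) (hinj : Set.InjOn f A) {μ μ' : Measure X}
    (hμ : μ Aᶜ = 0) (hμ' : μ' Aᶜ = 0) (h : μ.map f = μ'.map f) : μ = μ' := by
  have key : ∀ (m : Measure X), m Aᶜ = 0 → ∀ s, MeasurableSet s →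
      m s = m.map f (f '' (s ∩ A)) := by
    intro m hm s hs
    rw [Measure.map_apply hf ((hs.inter hA).image_of_measurable_injOn hf
      (hinj.mono Set.inter_subset_right)), ← measure_inter_conull hm,
      ← measure_inter_conull (s := f ⁻¹' _) hm]
    congr 1
    ext x
    constructor
    · rintro ⟨hx, hxA⟩
      exact ⟨⟨x, ⟨hx, hxA⟩, rfl⟩, hxA⟩
    · rintro ⟨⟨y, ⟨hy, hyA⟩, hyx⟩, hxA⟩
      rw [← hinj hyA hxA hyx]
      exact ⟨hy, hyA⟩
  ext s hs
  rw [key μ hμ s hs, key μ' hμ' s hs, h]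

theorem IsAreaPiece.sigmaFinite_restrict {X Y : Type*} [MeasurableSpace X] [MeasurableSpace Y]
    {ν : Measure X} {lam : Measure Y} [SigmaFinite lam] {f : X → Y} (hf : Measurable f)
    {j : X → ℝ≥0∞} {A : Set X} (h : IsAreaPiece ν lam f j A) : SigmaFinite (ν.restrict A) := by
  have h1 : SigmaFinite (((ν.restrict A).withDensity j).map f) := by
    rw [h.map_eq]; infer_instance
  have h2 : SigmaFinite ((ν.restrict A).withDensity j) := .of_map _ hf.aemeasurable h1
  have h0 : ∀ᵐ x ∂ν.restrict A, j x ≠ 0 := ae_restrict_of_forall_mem h.measurableSet h.ne_zero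
  have ht : ∀ᵐ x ∂ν.restrict A, j x ≠ ∞ := ae_restrict_of_forall_mem h.measurableSet h.ne_top
  rw [← withDensity_inv_same₀ h.aemeasurable h0 ht]
  refine SigmaFinite.withDensity_of_ne_top ?_
  exact (withDensity_absolutelyContinuous _ _).ae_le (h0.mono fun x hx => by simpa using hx)

theorem sigmaFinite_of_countable_cover {X ι : Type*} [MeasurableSpace X] [Countable ι]
    {ν : Measure X} {A : ι → Set X} (hA : ∀ i, MeasurableSet (A i))
    (hσ : ∀ i, SigmaFinite (ν.restrict (A i))) (hcov : ν (⋃ i, A i)ᶜ = 0) : SigmaFinite ν := by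
  refine Measure.sigmaFinite_of_countable (S := insert (⋃ i, A i)ᶜ
    (Set.range fun p : ι × ℕ => A p.1 ∩ spanningSets (ν.restrict (A p.1)) p.2)) ?_ ?_ ?_
  · exact (Set.countable_range _).insert _
  · rintro s (rfl | ⟨⟨i, k⟩, rfl⟩)
    · rw [hcov]
      exact ENNReal.zero_lt_top
    · have := measure_spanningSets_lt_top (ν.restrict (A i)) k
      rwa [Measure.restrict_apply' (hA i), Set.inter_comm] at this
  · rw [Set.sUnion_insert, Set.eq_univ_iff_forall]
    intro x
    by_cases hx : x ∈ ⋃ i, A i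
    · obtain ⟨i, hi⟩ := Set.mem_iUnion.1 hx
      refine Or.inr ⟨_, ⟨(i, spanningSetsIndex (ν.restrict (A i)) x), rfl⟩, hi, ?_⟩
      exact mem_spanningSetsIndex _ _
    · exact Or.inl hx

/-! ### The regular conditional distribution given the image point -/

section condDistrib

variable {X Y : Type*} [MeasurableSpace X] [StandardBorelSpace X] [Nonempty X]
  [MeasurableSpace Y] {P : Measure X} [IsProbabilityMeasure P] {f : X → Y}

/-- A property of the pair `(f x, x)` which holds almost surely holds almost surely under the
conditional distributions. -/
theorem ae_ae_condDistrib_of_ae (hf : Measurable f) {p : Y × X → Prop}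
    (hp : MeasurableSet {y | p y}) (h : ∀ᵐ x ∂P, p (f x, x)) :
    ∀ᵐ x ∂P, ∀ᵐ y ∂(condDistrib id f P (f x)), p (f x, y) := by
  have h1 : ∀ᵐ y ∂(P.map f ⊗ₘ condDistrib id f P), p y := by
    rw [compProd_map_condDistrib aemeasurable_id]
    exact (ae_map_iff (by fun_prop) hp).2 h
  exact ae_of_ae_map hf.aemeasurable (Measure.ae_ae_of_ae_compProd h1)

/-- The conditional distribution given `f = z` is carried by the fibre over `z`. -/
theorem ae_ae_condDistrib_fiber [StandardBorelSpace Y] (hf : Measurable f) :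
    ∀ᵐ x ∂P, ∀ᵐ y ∂(condDistrib id f P (f x)), f y = f x :=
  ae_ae_condDistrib_of_ae hf (p := fun y => f y.2 = y.1)
    (measurableSet_eq_fun (by fun_prop) (by fun_prop)) (Filter.Eventually.of_forall fun _ => rfl)

/-- On a set on which `f` is injective, the mass of the point under the conditional distribution is
the mass of the whole set. -/
theorem ae_condDistrib_singleton_eq [StandardBorelSpace Y] (hf : Measurable f) {A : Set X}
    (hinj : Set.InjOn f A) :
    ∀ᵐ x ∂P, x ∈ A → condDistrib id f P (f x) {x} = condDistrib id f P (f x) A := by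
  filter_upwards [ae_ae_condDistrib_fiber (P := P) hf] with x hx hxA
  refine measure_congr ?_
  filter_upwards [hx] with y hy
  refine propext ⟨fun h => ?_, fun h => ?_⟩
  · have : y = x := h
    rw [this]; exact hxA
  · exact hinj h hxA hy

theorem measurable_condDistrib_singleton (hf : Measurable f) :
    Measurable fun x => condDistrib id f P (f x) {x} := by
  have h : MeasurableSet {p : X × X | p.1 = p.2} := measurableSet_eq_fun (by fun_prop) (by fun_prop)
  have := Kernel.measurable_kernel_prodMk_left (κ := (condDistrib id f P).comap f hf) h
  convert this using 2 with x
  rw [Kernel.comap_apply]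
  congr 1
  ext y
  simp [eq_comm]

theorem lintegral_neg_log_condDistrib_eq_zero_iff (hf : Measurable f) :
    ∫⁻ x, (-ENNReal.log (condDistrib id f P (f x) {x})).toENNReal ∂P = 0 ↔
      ∀ᵐ x ∂P, condDistrib id f P (f x) {x} = 1 := by
  rw [lintegral_eq_zero_iff]
  · refine Filter.eventually_congr (Filter.Eventually.of_forall fun x => ?_)
    have h1 : condDistrib id f P (f x) {x} ≤ 1 := prob_le_one
    simp only [Pi.zero_apply, EReal.toENNReal_eq_zero_iff]
    rw [EReal.neg_le, neg_zero, ← ENNReal.log_one, ENNReal.log_le_log_iff]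
    exact ⟨fun h => le_antisymm h1 h, fun h => h.ge⟩
  · have := measurable_condDistrib_singleton (P := P) hf
    have := ENNReal.measurable_log.comp this
    exact this.neg.ereal_toENNReal

/-- The conditional distribution is almost surely a point mass exactly when `f` is injective
outside a null set. -/
theorem ae_condDistrib_singleton_eq_one_iff [StandardBorelSpace Y] (hf : Measurable f) :
    (∀ᵐ x ∂P, condDistrib id f P (f x) {x} = 1) ↔ ∃ S : Set X, P Sᶜ = 0 ∧ Set.InjOn f S := by
  constructor
  · intro h
    refine ⟨{x | condDistrib id f P (f x) {x} = 1}, h, fun x hx y hy hxy => ?_⟩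
    by_contra hne
    have h2 := measure_union (μ := condDistrib id f P (f x)) (s₁ := {x}) (s₂ := {y})
      (by simpa using hne) (measurableSet_singleton y)
    have hx' : condDistrib id f P (f x) {x} = 1 := hx
    have hy' : condDistrib id f P (f x) {y} = 1 := by rw [hxy]; exact hy
    rw [hx', hy'] at h2
    have h3 : condDistrib id f P (f x) ({x} ∪ {y}) ≤ 1 := prob_le_one
    rw [h2] at h3
    norm_num at h3
  · rintro ⟨S, hS, hinj⟩
    obtain ⟨T, hTS, hT, hT0⟩ := exists_measurable_superset_of_null hS
    have hTc : ∀ᵐ x ∂P, x ∈ Tᶜ := by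
      rw [ae_iff]; simpa using hT0
    have hinj' : Set.InjOn f Tᶜ := hinj.mono (Set.compl_subset_comm.1 hTS)
    filter_upwards [ae_condDistrib_singleton_eq (P := P) hf hinj', hTc,
      ae_ae_condDistrib_of_ae hf (p := fun y => y.2 ∈ Tᶜ)
        (measurable_snd hT.compl) hTc] with x h1 h2 h3
    rw [h1 h2]
    exact prob_compl_eq_zero_iff hT.compl |>.1 h3

end condDistrib

/-! ### The density identity and the entropy decomposition -/

section AreaPieces

variable {X Y ι : Type*} [MeasurableSpace X] [MeasurableSpace Y] [Countable ι] {ν : Measure X}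
  {lam : Measure Y} {f : X → Y} {j : X → ℝ≥0∞} {A : ι → Set X} {P : Measure X}

theorem map_absolutelyContinuous_of_isAreaPiece (hf : Measurable f)
    (hA : ∀ i, IsAreaPiece ν lam f j (A i)) (hcov : ν (⋃ i, A i)ᶜ = 0) (hP : P ≪ ν) :
    P.map f ≪ lam := by
  refine Measure.AbsolutelyContinuous.mk fun C hC h0 => ?_
  rw [Measure.map_apply hf hC]
  refine hP ?_
  rw [← measure_inter_conull hcov, Set.inter_iUnion]
  refine measure_iUnion_null fun i => ?_
  have h1 : ((ν.restrict (A i)).withDensity j) (f ⁻¹' C) = 0 := by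
    rw [← Measure.map_apply hf hC, (hA i).map_eq]
    exact measure_mono_null (le_refl _) (Measure.absolutelyContinuous_of_le
      Measure.restrict_le_self h0)
  rw [withDensity_apply_eq_zero' (hA i).aemeasurable, Measure.restrict_apply' (hA i).measurableSet]
    at h1
  refine measure_mono_null ?_ h1
  exact fun x hx => ⟨⟨(hA i).ne_zero x hx.2, hx.1⟩, hx.2⟩

/-- On a piece, `f` maps null sets to null sets. -/
theorem IsAreaPiece.measure_image_inter_eq_zero [StandardBorelSpace X]
    [MeasurableSpace.CountablySeparated Y] (hf : Measurable f) {B : Set X}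
    (hB : IsAreaPiece ν lam f j B) {N : Set X} (hN : ν N = 0) : lam (f '' (B ∩ N)) = 0 := by
  obtain ⟨T, hNT, hT, hT0⟩ := exists_measurable_superset_of_null hN
  refine measure_mono_null (Set.image_mono (Set.inter_subset_inter_right B hNT)) ?_
  have hm : MeasurableSet (f '' (B ∩ T)) := (hB.measurableSet.inter hT).image_of_measurable_injOn hf
    (hB.injOn.mono Set.inter_subset_left)
  have h1 : f ⁻¹' (f '' (B ∩ T)) ∩ B ⊆ T := by
    rintro x ⟨⟨y, hy, hyx⟩, hx⟩
    exact hB.injOn hy.1 hx hyx ▸ hy.2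
  have h2 : (ν.restrict B) (f ⁻¹' (f '' (B ∩ T))) = 0 := by
    rw [Measure.restrict_apply' hB.measurableSet]
    exact measure_mono_null h1 hT0
  have h3 := withDensity_absolutelyContinuous (ν.restrict B) j h2
  rwa [← Measure.map_apply hf hm, hB.map_eq, Measure.restrict_apply hm,
    Set.inter_eq_left.2 (Set.image_mono Set.inter_subset_left)] at h3

theorem aemeasurable_of_isAreaPiece (hA : ∀ i, IsAreaPiece ν lam f j (A i))
    (hcov : ν (⋃ i, A i)ᶜ = 0) : AEMeasurable j ν := by
  have h := (aemeasurable_iUnion_iff (μ := ν) (f := j) (s := A)).2 fun i => (hA i).aemeasurable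
  rwa [Measure.restrict_eq_self_of_ae_mem (s := ⋃ i, A i) hcov] at h

variable [StandardBorelSpace X] [Nonempty X] [StandardBorelSpace Y] [SigmaFinite lam]
  [IsProbabilityMeasure P]

/-- On a piece `B`, both sides are densities with respect to `ν` of measures carried by `B`, and
these have the same image under `f`. -/
theorem ae_rnDeriv_eq_condDistrib_mul_of_isAreaPiece [SigmaFinite ν] (hf : Measurable f)
    {B : Set X} (hB : IsAreaPiece ν lam f j B) (hP : P ≪ ν) (hR : P.map f ≪ lam) :
    ∀ᵐ x ∂ν.restrict B, P.rnDeriv ν x =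
      condDistrib id f P (f x) B * (P.map f).rnDeriv lam (f x) * j x := by
  have hBm := hB.measurableSet
  have hκ : Measurable fun z => condDistrib id f P z B := Kernel.measurable_coe _ hBm
  have hr : Measurable ((P.map f).rnDeriv lam) := Measure.measurable_rnDeriv _ _
  set h : Y → ℝ≥0∞ := fun z => condDistrib id f P z B * (P.map f).rnDeriv lam z with hh
  have hhm : Measurable h := hκ.mul hr
  have hPB : (ν.restrict B).withDensity (P.rnDeriv ν) = P.restrict B := by
    rw [← restrict_withDensity hBm, Measure.withDensity_rnDeriv_eq _ _ hP]
  have hfB : MeasurableSet (f '' B) := hBm.image_of_measurable_injOn hf hB.injOn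
  -- the image of `P` on `B` has density `P(B | f = z)` with respect to the image of `P`
  have h1 : (P.restrict B).map f = lam.withDensity h := by
    have e : lam.withDensity h
        = (P.map f).withDensity fun z => condDistrib id f P z B := by
      conv_rhs => rw [← Measure.withDensity_rnDeriv_eq _ _ hR]
      rw [← withDensity_mul _ hr hκ]
      congr 1
      ext z
      simp [hh, mul_comm]
    rw [e]
    ext C hC
    rw [Measure.map_apply hf hC, Measure.restrict_apply (hf hC), withDensity_apply _ hC,
      ← Measure.restrict_map hf hC |>.symm, lintegral_map hκ hf,
      setLIntegral_preimage_condDistrib hf aemeasurable_id hBm hC]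
    rfl
  have h2 : ((ν.restrict B).withDensity fun x => j x * h (f x)).map f = (P.restrict B).map f := by
    have e : ((ν.restrict B).withDensity fun x => j x * h (f x))
        = ((ν.restrict B).withDensity j).withDensity fun x => h (f x) :=
      withDensity_mul₀ hB.aemeasurable (by fun_prop)
    rw [e, map_withDensity_comp hf.aemeasurable hhm.aemeasurable, hB.map_eq,
      ← restrict_withDensity hfB, ← h1,
      Measure.restrict_map hf hfB]
    congr 1
    refine Measure.restrict_eq_self_of_ae_mem ?_
    exact ae_restrict_of_forall_mem hBm fun x hx => ⟨x, hx, rfl⟩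
  have h3 : (ν.restrict B).withDensity (fun x => j x * h (f x)) = P.restrict B := by
    refine measure_eq_of_map_eq_of_injOn hf hBm hB.injOn ?_ ?_ h2
    · exact withDensity_absolutelyContinuous _ _ (by simp [Measure.restrict_apply hBm.compl])
    · simp [Measure.restrict_apply hBm.compl]
  rw [← hPB] at h3
  have h4 := (withDensity_eq_iff_of_sigmaFinite (hB.aemeasurable.mul (by fun_prop))
    (Measure.measurable_rnDeriv _ _).aemeasurable).1 h3
  filter_upwards [h4] with x hx
  rw [← hx]
  exact mul_comm _ _

/-- The density of `P` at a point is the product of the conditional mass of the point given its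
image, the density of the image measure, and the volume distortion of `f`. -/
theorem ae_rnDeriv_eq_condDistrib_singleton_mul [SigmaFinite ν] (hf : Measurable f)
    (hA : ∀ i, IsAreaPiece ν lam f j (A i)) (hcov : ν (⋃ i, A i)ᶜ = 0) (hP : P ≪ ν) :
    ∀ᵐ x ∂P, P.rnDeriv ν x =
      condDistrib id f P (f x) {x} * (P.map f).rnDeriv lam (f x) * j x := by
  have hR := map_absolutelyContinuous_of_isAreaPiece hf hA hcov hP
  have h1 : ∀ i, ∀ᵐ x ∂P, x ∈ A i → P.rnDeriv ν x =
      condDistrib id f P (f x) (A i) * (P.map f).rnDeriv lam (f x) * j x := fun i =>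
    hP.ae_le ((ae_restrict_iff' (hA i).measurableSet).1
      (ae_rnDeriv_eq_condDistrib_mul_of_isAreaPiece hf (hA i) hP hR))
  have h2 : ∀ i, ∀ᵐ x ∂P, x ∈ A i →
      condDistrib id f P (f x) {x} = condDistrib id f P (f x) (A i) := fun i =>
    ae_condDistrib_singleton_eq hf (hA i).injOn
  have h3 : ∀ᵐ x ∂P, x ∈ ⋃ i, A i := hP hcov
  filter_upwards [ae_all_iff.2 h1, ae_all_iff.2 h2, h3] with x h1 h2 h3
  obtain ⟨i, hi⟩ := Set.mem_iUnion.1 h3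
  rw [h1 i hi, h2 i hi]

/-- Taking logarithms in the density identity gives
`-log r(f(x)) = -log p(x) + log j(x) + log P(x | f(x))`. The last term is nonpositive, so the means
of all three terms differ from `∞`, or all three differ from `-∞`, and they can be added. -/
theorem hasDifferentialEntropy_map_of_isAreaPiece (hf : Measurable f)
    (hA : ∀ i, IsAreaPiece ν lam f j (A i)) (hcov : ν (⋃ i, A i)ᶜ = 0) {h b : EReal}
    (hh : HasDifferentialEntropy P ν h) (hb : HasMean P (fun x => ENNReal.log (j x)) b)
    (hdef : (h ≠ ⊤ ∧ b ≠ ⊤) ∨ (h ≠ ⊥ ∧ b ≠ ⊥ ∧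
      ∫⁻ x, (-ENNReal.log (condDistrib id f P (f x) {x})).toENNReal ∂P ≠ ∞)) :
    HasDifferentialEntropy (P.map f) lam (h + b -
      ((∫⁻ x, (-ENNReal.log (condDistrib id f P (f x) {x})).toENNReal ∂P : ℝ≥0∞) : EReal)) := by
  obtain ⟨hP, hh⟩ := hh
  have hσ : SigmaFinite ν := sigmaFinite_of_countable_cover (fun i => (hA i).measurableSet)
    (fun i => (hA i).sigmaFinite_restrict hf) hcov
  have hR := map_absolutelyContinuous_of_isAreaPiece hf hA hcov hP
  refine ⟨hR, ?_⟩
  have hr : Measurable ((P.map f).rnDeriv lam) := Measure.measurable_rnDeriv _ _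
  have hp : Measurable (P.rnDeriv ν) := Measure.measurable_rnDeriv _ _
  have hk := measurable_condDistrib_singleton (P := P) hf
  have hj : AEMeasurable j P := (aemeasurable_of_isAreaPiece hA hcov).mono_ac hP
  rw [hasMean_map_iff hf.aemeasurable (by fun_prop)]
  have hid := ae_rnDeriv_eq_condDistrib_singleton_mul hf hA hcov hP
  have hp0 := Measure.rnDeriv_pos hP
  have hpt := hP.ae_le (Measure.rnDeriv_lt_top P ν)
  have hr0 := ae_of_ae_map hf.aemeasurable (Measure.rnDeriv_pos hR)
  have hrt := ae_of_ae_map hf.aemeasurable (hR.ae_le (Measure.rnDeriv_lt_top (P.map f) lam))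
  have hjt : ∀ᵐ x ∂P, j x ≠ ∞ := by
    have h3 : ∀ᵐ x ∂P, x ∈ ⋃ i, A i := hP hcov
    filter_upwards [h3] with x hx
    obtain ⟨i, hi⟩ := Set.mem_iUnion.1 hx
    exact (hA i).ne_top x hi
  have he := hasMean_of_nonneg (μ := P)
    (g := fun x => -ENNReal.log (condDistrib id f P (f x) {x})) (.of_forall fun x => by
      rw [EReal.le_neg, neg_zero, ← ENNReal.log_one, ENNReal.log_le_log_iff]
      exact prob_le_one)
  set E := ∫⁻ x, (-ENNReal.log (condDistrib id f P (f x) {x})).toENNReal ∂P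
  have he' := he.neg
  have ha' : HasMean P (fun x => ((-Real.log (P.rnDeriv ν x).toReal : ℝ) : EReal)) h := by
    refine hh.congr ?_
    filter_upwards [hp0, hpt] with x h0 ht
    rw [EReal.coe_neg, ENNReal.log_pos_real h0.ne' ht.ne]
  have hb' : HasMean P (fun x => ((Real.log (j x).toReal : ℝ) : EReal)) b := by
    refine hb.congr ?_
    filter_upwards [hjt, hid, hp0] with x ht hid h0
    rw [ENNReal.log_pos_real (fun h => by simp [hid, h] at h0) ht]
  have hc' : HasMean P (fun x =>
      ((Real.log (condDistrib id f P (f x) {x}).toReal : ℝ) : EReal)) (-(E : EReal)) := by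
    refine he'.congr ?_
    filter_upwards [hid, hp0] with x hid h0
    rw [neg_neg, ENNReal.log_pos_real (fun h => by simp [hid, h] at h0) (measure_ne_top _ _)]
  have hjm : AEMeasurable (fun x => Real.log (j x).toReal) P := hj.ennreal_toReal.log
  have hab := HasMean.add (hp.ennreal_toReal.log.neg.aemeasurable) hjm ha' hb'
    (hdef.imp id fun h => ⟨h.1, h.2.1⟩)
  have habc := HasMean.add (hp.ennreal_toReal.log.neg.aemeasurable.add hjm)
    (hk.ennreal_toReal.log.aemeasurable) hab hc' (by
      rcases hdef with h | h
      · exact Or.inl ⟨EReal.add_ne_top h.1 h.2, by simp⟩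
      · exact Or.inr ⟨EReal.add_ne_bot_iff.2 ⟨h.1, h.2.1⟩, by simpa using h.2.2⟩)
  rw [← sub_eq_add_neg] at habc
  refine habc.congr ?_
  filter_upwards [hid, hp0, hpt, hr0, hrt, hjt] with x hid hp0 hpt hr0 hrt hjt
  have hk0 : condDistrib id f P (f x) {x} ≠ 0 := fun h => by simp [hid, h] at hp0
  have hj0 : j x ≠ 0 := fun h => by simp [hid, h] at hp0
  have hkt : condDistrib id f P (f x) {x} ≠ ∞ := measure_ne_top _ _
  simp only [Pi.add_apply, Pi.neg_apply]
  rw [ENNReal.log_pos_real hr0.ne' hrt.ne, ← EReal.coe_neg, hid, ENNReal.toReal_mul,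
    ENNReal.toReal_mul, Real.log_mul, Real.log_mul]
  · congr 1
    ring
  all_goals simp [ENNReal.toReal_eq_zero_iff, *, hr0.ne', hrt.ne]

end AreaPieces

/-! ### The area formula for immersions -/

section Immersion

open scoped NNReal Topology

variable {E F : Type*} [NormedAddCommGroup E] [InnerProductSpace ℝ E] [FiniteDimensional ℝ E]
  [NormedAddCommGroup F] [InnerProductSpace ℝ F]

theorem euclideanHausdorffMeasure_image_le_of_dist_le {α X Y : Type*} [MetricSpace X]
    [MeasurableSpace X] [BorelSpace X] [MetricSpace Y] [MeasurableSpace Y] [BorelSpace Y]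
    (n : ℕ) {p : α → X} {q : α → Y} {A : Set α} {C : ℝ≥0}
    (h : ∀ a ∈ A, ∀ b ∈ A, dist (p a) (p b) ≤ C * dist (q a) (q b)) :
    μHE[n] (p '' A) ≤ C ^ n * μHE[n] (q '' A) := by
  rcases A.eq_empty_or_nonempty with rfl | ⟨a₀, ha₀⟩
  · simp
  have : Nonempty α := ⟨a₀⟩
  set g : Y → X := p ∘ Function.invFunOn q A with hg
  have hmem : ∀ y ∈ q '' A, Function.invFunOn q A y ∈ A := fun y hy => Function.invFunOn_mem hy
  have heq : ∀ y ∈ q '' A, q (Function.invFunOn q A y) = y := fun y hy => Function.invFunOn_eq hy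
  have hL : LipschitzOnWith C g (q '' A) := by
    refine LipschitzOnWith.of_dist_le_mul fun y hy z hz => ?_
    have := h _ (hmem y hy) _ (hmem z hz)
    rwa [heq y hy, heq z hz] at this
  have him : g '' (q '' A) = p '' A := by
    rw [Set.image_image]
    refine Set.image_congr fun a ha => ?_
    have h1 := h _ (hmem _ ⟨a, ha, rfl⟩) a ha
    rw [heq _ ⟨a, ha, rfl⟩, dist_self, mul_zero] at h1
    exact dist_le_zero.1 h1
  have := hL.hausdorffMeasure_image_le (d := n) (Nat.cast_nonneg n)
  rw [him, ENNReal.rpow_natCast] at this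
  simp only [Measure.euclideanHausdorffMeasure_def, Measure.smul_apply, ENNReal.smul_def,
    smul_eq_mul]
  exact (mul_le_mul_right this _).trans_eq (mul_left_comm _ _ _)

theorem continuous_normDet [FiniteDimensional ℝ F] :
    Continuous fun L : E →L[ℝ] F => (L : E →ₗ[ℝ] F).normDet := by
  have h : (fun L : E →L[ℝ] F => (L : E →ₗ[ℝ] F).normDet) =
      fun L => √((ContinuousLinearMap.adjoint L).comp L).det := by
    ext L
    have := L.normDet_sq
    simp only [RCLike.ofReal_real_eq_id, id_eq] at this
    rw [← this, Real.sqrt_sq (LinearMap.normDet_nonneg _)]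
  rw [h]
  refine Real.continuous_sqrt.comp (ContinuousLinearMap.continuous_det.comp ?_)
  exact ((ContinuousLinearMap.adjoint (𝕜 := ℝ) (E := E) (F := F)).continuous).clm_comp
    continuous_id

theorem exists_one_lt_pow_le {t : ℝ≥0} (ht : 1 < t) (n : ℕ) : ∃ C : ℝ≥0, 1 < C ∧ C ^ n ≤ t := by
  -- the exponent `1 / (n + 1)` also covers `n = 0`
  refine ⟨t ^ ((n + 1 : ℝ)⁻¹), NNReal.one_lt_rpow ht (by positivity), ?_⟩
  have h1 : 1 ≤ t ^ ((n + 1 : ℝ)⁻¹) := (NNReal.one_lt_rpow ht (by positivity)).le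
  calc _ ≤ (t ^ ((n + 1 : ℝ)⁻¹)) ^ (n + 1) := pow_le_pow_right₀ h1 (Nat.le_succ n)
    _ = t := by
      rw [← NNReal.rpow_natCast, ← NNReal.rpow_mul]
      push_cast
      rw [inv_mul_cancel₀ (by positivity), NNReal.rpow_one]

variable [MeasurableSpace E] [BorelSpace E] [MeasurableSpace F] [BorelSpace F]

/-- Near a point at which its derivative `L` is injective, a map distorts volumes like `L` up to a
factor arbitrarily close to `1`, since there `φ` and `L` are bi-Lipschitz equivalent with constant
close to `1`. -/
theorem exists_nhds_euclideanHausdorffMeasure_image_le {φ : E → F} {L : E →L[ℝ] F} {u : E}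
    (h : HasStrictFDerivAt φ L u) (hL : Function.Injective L) {t : ℝ≥0} (ht : 1 < t) :
    ∃ V ∈ 𝓝 u, ∀ A ⊆ V,
      μHE[Module.finrank ℝ E] (φ '' A)
        ≤ t * (ENNReal.ofReal (L : E →ₗ[ℝ] F).normDet * volume A) ∧
      ENNReal.ofReal (L : E →ₗ[ℝ] F).normDet * volume A
        ≤ t * μHE[Module.finrank ℝ E] (φ '' A) := by
  obtain ⟨C, hC, hCt⟩ := exists_one_lt_pow_le ht (Module.finrank ℝ E)
  have hCt' : (C : ℝ≥0∞) ^ Module.finrank ℝ E ≤ t := by exact_mod_cast hCt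
  obtain ⟨K, hK, hKL⟩ := (L : E →ₗ[ℝ] F).exists_antilipschitzWith (LinearMap.ker_eq_bot.2 hL)
  have hKL' : ∀ a b, dist a b ≤ K * dist (L a) (L b) := hKL.le_mul_dist
  have hC' : (1 : ℝ) < C := by exact_mod_cast hC
  have hK' : (0 : ℝ) < K := by exact_mod_cast hK
  have hCi : (C : ℝ)⁻¹ < 1 := inv_lt_one_of_one_lt₀ hC'
  -- with this precision, `φ` differs from `L` by at most `(1 - C⁻¹) ‖L (a - b)‖`
  set c : ℝ≥0 := ⟨(1 - (C : ℝ)⁻¹) / K, by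
    have := sub_pos.2 hCi
    positivity⟩ with hc
  have hcpos : 0 < c := by
    rw [← NNReal.coe_pos]
    exact div_pos (sub_pos.2 hCi) hK'
  obtain ⟨V, hV, happ⟩ := h.approximates_deriv_on_nhds (c := c) (Or.inr hcpos)
  have key : ∀ a ∈ V, ∀ b ∈ V, ‖φ a - φ b - L (a - b)‖ ≤ (1 - (C : ℝ)⁻¹) * ‖L (a - b)‖ := by
    intro a ha b hb
    refine (happ a ha b hb).trans ?_
    have h1 := hKL' a b
    rw [dist_eq_norm, dist_eq_norm, ← map_sub] at h1
    calc (c : ℝ) * ‖a - b‖ ≤ c * (K * ‖L (a - b)‖) := by gcongr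
      _ = _ := by
        change (1 - (C : ℝ)⁻¹) / K * _ = _
        field_simp
  refine ⟨V, hV, fun A hA => ?_⟩
  rw [← LinearMap.euclideanHausdorffMeasure_image_eq_normDet_mul_volume]
  constructor
  · refine (euclideanHausdorffMeasure_image_le_of_dist_le _ (q := L) (C := C) ?_).trans ?_
    · intro a ha b hb
      rw [dist_eq_norm, dist_eq_norm, ← map_sub]
      have h1 := key a (hA ha) b (hA hb)
      have h2 := norm_le_norm_add_norm_sub' (φ a - φ b) (L (a - b))
      have h3 : 2 - (C : ℝ)⁻¹ ≤ C := by
        have : (C : ℝ) * (C : ℝ)⁻¹ = 1 := mul_inv_cancel₀ (by positivity)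
        nlinarith [sq_nonneg ((C : ℝ) - 1)]
      nlinarith [norm_nonneg (L (a - b))]
    · gcongr
      exact le_of_eq rfl
  · refine (euclideanHausdorffMeasure_image_le_of_dist_le _ (p := L) (q := φ) (C := C) ?_).trans ?_
    · intro a ha b hb
      rw [dist_eq_norm, dist_eq_norm, ← map_sub]
      have h1 := key a (hA ha) b (hA hb)
      have h2 := norm_le_norm_add_norm_sub (φ a - φ b) (L (a - b))
      have h3 : (C : ℝ)⁻¹ * ‖L (a - b)‖ ≤ ‖φ a - φ b‖ := by linarith
      rwa [inv_mul_le_iff₀ (by positivity)] at h3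
    · gcongr

theorem ENNReal.le_of_forall_one_lt_le_mul {a b : ℝ≥0∞}
    (h : ∀ t : ℝ≥0, 1 < t → a ≤ t * b) : a ≤ b := by
  have h1 : Filter.Tendsto (fun t : ℝ≥0 => (t : ℝ≥0∞) * b) (𝓝[>] 1) (𝓝 (1 * b)) := by
    refine ENNReal.Tendsto.mul_const ?_ (Or.inl one_ne_zero)
    exact (ENNReal.continuous_coe.tendsto' 1 1 (by simp)).mono_left nhdsWithin_le_nhds
  rw [one_mul] at h1
  exact ge_of_tendsto h1 (eventually_mem_nhdsWithin.mono h)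

/-- Near each point of its domain, an immersion satisfies the area formula up to a factor
arbitrarily close to `1`. -/
theorem exists_nhds_euclideanHausdorffMeasure_image_le_lintegral [FiniteDimensional ℝ F]
    {φ : E → F} {U : Set E}
    (hU : IsOpen U) (hφ : ContDiffOn ℝ 1 φ U) {u : E} (hu : u ∈ U)
    (hinj : Function.Injective (fderiv ℝ φ u)) {t : ℝ≥0} (ht : 1 < t) :
    ∃ V ∈ 𝓝 u, ∀ A ⊆ V, MeasurableSet A →
      μHE[Module.finrank ℝ E] (φ '' A)
        ≤ t * ∫⁻ v in A, ENNReal.ofReal (fderiv ℝ φ v : E →ₗ[ℝ] F).normDet ∧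
      ∫⁻ v in A, ENNReal.ofReal (fderiv ℝ φ v : E →ₗ[ℝ] F).normDet
        ≤ t * μHE[Module.finrank ℝ E] (φ '' A) := by
  obtain ⟨s, hs, hst⟩ := exists_one_lt_pow_le ht 2
  have hs0 : s ≠ 0 := (zero_lt_one.trans hs).ne'
  have hst' : (s : ℝ≥0∞) * s ≤ t := by rw [← sq]; exact_mod_cast hst
  have hφu : ContDiffAt ℝ 1 φ u := hφ.contDiffAt (hU.mem_nhds hu)
  obtain ⟨V, hV, hVA⟩ := exists_nhds_euclideanHausdorffMeasure_image_le
    (hφu.hasStrictFDerivAt one_ne_zero) hinj hs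
  set D : E → ℝ≥0∞ := fun v => ENNReal.ofReal (fderiv ℝ φ v : E →ₗ[ℝ] F).normDet with hD
  have hcont : ContinuousAt D u := by
    have h1 : ContinuousAt (fderiv ℝ φ) u :=
      (hφ.continuousOn_fderiv_of_isOpen hU le_rfl).continuousAt (hU.mem_nhds hu)
    exact ENNReal.continuous_ofReal.continuousAt.comp
      (continuous_normDet.continuousAt.comp h1)
  have hD0 : D u ≠ 0 := by
    have : (fderiv ℝ φ u : E →ₗ[ℝ] F).normDet ≠ 0 :=
      ((fderiv ℝ φ u : E →ₗ[ℝ] F).normDet_ne_zero_tfae.out 0 1).2 (LinearMap.ker_eq_bot.2 hinj)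
    have := (LinearMap.normDet_nonneg (fderiv ℝ φ u : E →ₗ[ℝ] F)).lt_of_ne' this
    simpa [hD] using this
  have hDt : D u ≠ ∞ := ENNReal.ofReal_ne_top
  have hs1 : (1 : ℝ≥0∞) < s := by exact_mod_cast hs
  have hlt : D u < s * D u := by
    conv_lhs => rw [← one_mul (D u)]
    exact ENNReal.mul_lt_mul_left hD0 hDt hs1
  have e1 : ∀ᶠ v in 𝓝 u, D v ≤ s * D u :=
    (hcont.eventually_lt continuousAt_const hlt).mono fun _ h => h.le
  have e2 : ∀ᶠ v in 𝓝 u, D u ≤ s * D v := by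
    have : ContinuousAt (fun v => s * D v) u :=
      ENNReal.Tendsto.const_mul hcont (Or.inl hD0)
    exact (continuousAt_const.eventually_lt this hlt).mono fun _ h => h.le
  refine ⟨V ∩ {v | D v ≤ s * D u ∧ D u ≤ s * D v}, Filter.inter_mem hV (e1.and e2),
    fun A hA hAm => ?_⟩
  obtain ⟨h1, h2⟩ := hVA A (hA.trans Set.inter_subset_left)
  have h3 : ∫⁻ v in A, D v ≤ s * (D u * volume A) := by
    rw [← mul_assoc, ← setLIntegral_const]
    exact setLIntegral_mono measurable_const fun v hv => (hA hv).2.1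
  have h4 : D u * volume A ≤ s * ∫⁻ v in A, D v := by
    rw [← setLIntegral_const, ← lintegral_const_mul' _ _ ENNReal.coe_ne_top]
    exact setLIntegral_mono' hAm fun v hv => (hA hv).2.2
  constructor
  · calc _ ≤ s * (D u * volume A) := h1
      _ ≤ s * (s * ∫⁻ v in A, D v) := by gcongr
      _ = s * s * ∫⁻ v in A, D v := by ring
      _ ≤ _ := by gcongr
  · calc _ ≤ s * (D u * volume A) := h3
      _ ≤ s * (s * μHE[Module.finrank ℝ E] (φ '' A)) := by gcongr
      _ = s * s * μHE[Module.finrank ℝ E] (φ '' A) := by ring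
      _ ≤ _ := by gcongr

/-- **Area formula** for an injective `C¹` immersion. -/
theorem euclideanHausdorffMeasure_image_eq_lintegral_normDet [FiniteDimensional ℝ F]
    {φ : E → F} {U : Set E}
    (hU : IsOpen U) (hφ : ContDiffOn ℝ 1 φ U)
    (hφ' : ∀ u ∈ U, Function.Injective (fderiv ℝ φ u)) (hinj : Set.InjOn φ U) {A : Set E}
    (hA : MeasurableSet A) (hAU : A ⊆ U) :
    μHE[Module.finrank ℝ E] (φ '' A)
      = ∫⁻ v in A, ENNReal.ofReal (fderiv ℝ φ v : E →ₗ[ℝ] F).normDet := by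
  -- sum the local estimates over a countable measurable partition
  have key : ∀ t : ℝ≥0, 1 < t → μHE[Module.finrank ℝ E] (φ '' A)
        ≤ t * ∫⁻ v in A, ENNReal.ofReal (fderiv ℝ φ v : E →ₗ[ℝ] F).normDet ∧
      ∫⁻ v in A, ENNReal.ofReal (fderiv ℝ φ v : E →ₗ[ℝ] F).normDet
        ≤ t * μHE[Module.finrank ℝ E] (φ '' A) := by
    intro t ht
    rcases A.eq_empty_or_nonempty with rfl | ⟨a₀, ha₀⟩
    · simp
    have hloc : ∀ u : A, ∃ V : Set E, IsOpen V ∧ (u : E) ∈ V ∧ ∀ B ⊆ V, MeasurableSet B →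
        μHE[Module.finrank ℝ E] (φ '' B)
          ≤ t * ∫⁻ v in B, ENNReal.ofReal (fderiv ℝ φ v : E →ₗ[ℝ] F).normDet ∧
        ∫⁻ v in B, ENNReal.ofReal (fderiv ℝ φ v : E →ₗ[ℝ] F).normDet
          ≤ t * μHE[Module.finrank ℝ E] (φ '' B) := by
      intro u
      obtain ⟨V, hV, h⟩ := exists_nhds_euclideanHausdorffMeasure_image_le_lintegral hU hφ
        (hAU u.2) (hφ' u (hAU u.2)) ht
      obtain ⟨W, hWV, hW, huW⟩ := mem_nhds_iff.1 hV
      exact ⟨W, hW, huW, fun B hB hBm => h B (hB.trans hWV) hBm⟩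
    choose V hVo hVm hV using hloc
    obtain ⟨T, hT, hTV⟩ := TopologicalSpace.isOpen_iUnion_countable V hVo
    have hne : T.Nonempty := by
      have : a₀ ∈ ⋃ i ∈ T, V i := hTV ▸ Set.mem_iUnion.2 ⟨⟨a₀, ha₀⟩, hVm ⟨a₀, ha₀⟩⟩
      obtain ⟨i, hi, -⟩ := Set.mem_iUnion₂.1 this
      exact ⟨i, hi⟩
    obtain ⟨x, rfl⟩ := hT.exists_eq_range hne
    set B : ℕ → Set E := fun k => A ∩ disjointed (fun k => V (x k)) k with hB
    have hBm : ∀ k, MeasurableSet (B k) := fun k =>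
      hA.inter (MeasurableSet.disjointed (fun k => (hVo (x k)).measurableSet) k)
    have hBd : Pairwise (Function.onFun Disjoint B) := fun k l hkl =>
      ((disjoint_disjointed _ hkl).mono Set.inter_subset_right Set.inter_subset_right)
    have hAB : A = ⋃ k, B k := by
      rw [← Set.inter_iUnion, iUnion_disjointed, eq_comm, Set.inter_eq_left]
      intro a ha
      have : a ∈ ⋃ i, V i := Set.mem_iUnion.2 ⟨⟨a, ha⟩, hVm ⟨a, ha⟩⟩
      rw [← hTV] at this
      simpa using this
    have hBV : ∀ k, B k ⊆ V (x k) := fun k =>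
      Set.inter_subset_right.trans (disjointed_subset _ _)
    have hBU : ∀ k, B k ⊆ U := fun k => Set.inter_subset_left.trans hAU
    have s1 : μHE[Module.finrank ℝ E] (φ '' A) = ∑' k, μHE[Module.finrank ℝ E] (φ '' B k) := by
      conv_lhs => rw [hAB, Set.image_iUnion]
      refine measure_iUnion (fun k l hkl => ?_) fun k => ?_
      · exact (hBd hkl).image hinj (hBU k) (hBU l)
      · exact (hBm k).image_of_continuousOn_injOn (hφ.continuousOn.mono (hBU k))
          (hinj.mono (hBU k))
    have s2 : ∫⁻ v in A, ENNReal.ofReal (fderiv ℝ φ v : E →ₗ[ℝ] F).normDet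
        = ∑' k, ∫⁻ v in B k, ENNReal.ofReal (fderiv ℝ φ v : E →ₗ[ℝ] F).normDet := by
      conv_lhs => rw [hAB]
      exact lintegral_iUnion hBm hBd _
    rw [s1, s2, ← ENNReal.tsum_mul_left, ← ENNReal.tsum_mul_left]
    exact ⟨ENNReal.tsum_le_tsum fun k => (hV (x k) (B k) (hBV k) (hBm k)).1,
      ENNReal.tsum_le_tsum fun k => (hV (x k) (B k) (hBV k) (hBm k)).2⟩
  exact le_antisymm (ENNReal.le_of_forall_one_lt_le_mul fun t ht => (key t ht).1)
    (ENNReal.le_of_forall_one_lt_le_mul fun t ht => (key t ht).2)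

end Immersion

/-! ### Charts of an embedded submanifold -/

section Chart

open scoped Topology

variable {d n : ℕ}

/-- `φ : U → M ∩ W` is a local parametrization of `M` with continuous inverse `ψ`, as in the
definition of an embedded submanifold. -/
structure IsParametrization (M W : Set (EuclideanSpace ℝ (Fin d)))
    (U : Set (EuclideanSpace ℝ (Fin n)))
    (φ : EuclideanSpace ℝ (Fin n) → EuclideanSpace ℝ (Fin d))
    (ψ : EuclideanSpace ℝ (Fin d) → EuclideanSpace ℝ (Fin n)) : Prop where
  isOpen_target : IsOpen W
  isOpen_source : IsOpen U
  contDiffOn : ContDiffOn ℝ 1 φ U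
  injective_fderiv : ∀ u ∈ U, Function.Injective (fderiv ℝ φ u)
  bijOn : Set.BijOn φ U (M ∩ W)
  leftInvOn : Set.LeftInvOn ψ φ U
  continuousOn_inv : ContinuousOn ψ (M ∩ W)

theorem IsEmbeddedSubmanifold.exists_isParametrization {M : Set (EuclideanSpace ℝ (Fin d))}
    (hM : IsEmbeddedSubmanifold n M) {x : EuclideanSpace ℝ (Fin d)} (hx : x ∈ M) :
    ∃ (W : Set (EuclideanSpace ℝ (Fin d))) (U : Set (EuclideanSpace ℝ (Fin n)))
      (φ : EuclideanSpace ℝ (Fin n) → EuclideanSpace ℝ (Fin d))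
      (ψ : EuclideanSpace ℝ (Fin d) → EuclideanSpace ℝ (Fin n)),
      x ∈ W ∧ IsParametrization M W U φ ψ := by
  obtain ⟨W, U, φ, ψ, h1, h2, h3, h4, h5, h6, h7, h8⟩ := hM x hx
  exact ⟨W, U, φ, ψ, h2, h1, h3, h4, h5, h6, h7, h8⟩

namespace IsParametrization

variable {M W : Set (EuclideanSpace ℝ (Fin d))} {U : Set (EuclideanSpace ℝ (Fin n))}
  {φ : EuclideanSpace ℝ (Fin n) → EuclideanSpace ℝ (Fin d)}
  {ψ : EuclideanSpace ℝ (Fin d) → EuclideanSpace ℝ (Fin n)}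
  {f : EuclideanSpace ℝ (Fin d) → EuclideanSpace ℝ (Fin n)}

theorem mem (h : IsParametrization M W U φ ψ) {u : EuclideanSpace ℝ (Fin n)} (hu : u ∈ U) :
    φ u ∈ M := (h.bijOn.mapsTo hu).1

theorem hasFDerivAt (h : IsParametrization M W U φ ψ) {u : EuclideanSpace ℝ (Fin n)}
    (hu : u ∈ U) : HasFDerivAt φ (fderiv ℝ φ u) u :=
  ((h.contDiffOn.contDiffAt (h.isOpen_source.mem_nhds hu)).differentiableAt one_ne_zero).hasFDerivAt

theorem inv_mem (h : IsParametrization M W U φ ψ) {x : EuclideanSpace ℝ (Fin d)}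
    (hx : x ∈ M ∩ W) : ψ x ∈ U ∧ φ (ψ x) = x := by
  obtain ⟨u, hu, rfl⟩ := h.bijOn.surjOn hx
  rw [h.leftInvOn hu]
  exact ⟨hu, rfl⟩

theorem nhdsWithin_eq (h : IsParametrization M W U φ ψ) {u : EuclideanSpace ℝ (Fin n)}
    (hu : u ∈ U) : 𝓝[M] (φ u) = 𝓝[M ∩ W] (φ u) :=
  (nhdsWithin_inter_of_mem' (mem_nhdsWithin_of_mem_nhds
    (h.isOpen_target.mem_nhds (h.bijOn.mapsTo hu).2))).symm

/-- A linear map vanishing on the range of `Dφ(u)` has derivative zero along `M` at `φ(u)`. -/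
theorem hasFDerivWithinAt_zero (h : IsParametrization M W U φ ψ)
    {u : EuclideanSpace ℝ (Fin n)} (hu : u ∈ U) {G : Type*} [NormedAddCommGroup G]
    [NormedSpace ℝ G] {ℓ : EuclideanSpace ℝ (Fin d) →L[ℝ] G} (hℓ : ∀ v, ℓ (fderiv ℝ φ u v) = 0) :
    HasFDerivWithinAt ℓ (0 : EuclideanSpace ℝ (Fin d) →L[ℝ] G) M (φ u) := by
  have hψ : Filter.Tendsto ψ (𝓝[M] (φ u)) (𝓝 u) := by
    rw [h.nhdsWithin_eq hu]
    have := h.continuousOn_inv (φ u) (h.bijOn.mapsTo hu)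
    rwa [ContinuousWithinAt, h.leftInvOn hu] at this
  have hinv : ∀ᶠ y in 𝓝[M] (φ u), φ (ψ y) = y := by
    rw [h.nhdsWithin_eq hu]
    exact eventually_mem_nhdsWithin.mono fun y hy => (h.inv_mem hy).2
  have h1 : HasFDerivAt (fun v => ℓ (φ v)) (0 : EuclideanSpace ℝ (Fin n) →L[ℝ] G) u := by
    have := ℓ.hasFDerivAt.comp u (h.hasFDerivAt hu)
    rwa [show ℓ.comp (fderiv ℝ φ u) = 0 from ContinuousLinearMap.ext hℓ] at this
  have h2 : (fun v => ℓ (φ v) - ℓ (φ u)) =o[𝓝 u] fun v => v - u := by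
    simpa using h1.isLittleO
  have hind : Topology.IsInducing (fderiv ℝ φ u) := (LinearMap.isClosedEmbedding_of_injective
    (f := (fderiv ℝ φ u).toLinearMap)
    (LinearMap.ker_eq_bot.2 (h.injective_fderiv u hu))).isInducing
  have h3 : (fun v => v - u) =O[𝓝 u] fun v => φ v - φ u :=
    ((h.hasFDerivAt hu).isTheta_sub hind).2
  have h4 := (h2.trans_isBigO h3).comp_tendsto hψ
  refine .of_isLittleO ?_
  refine h4.congr' ?_ ?_
  · filter_upwards [hinv] with y hy
    simp [hy]
  · filter_upwards [hinv] with y hy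
    simp [hy]

theorem tangentSubspace_eq (h : IsParametrization M W U φ ψ) {u : EuclideanSpace ℝ (Fin n)}
    (hu : u ∈ U) :
    tangentSubspace M (φ u)
      = (fderiv ℝ φ u).toLinearMap.range := by
  apply le_antisymm
  · set T := (fderiv ℝ φ u).toLinearMap.range with hT
    refine Submodule.span_le.2 fun v hv => ?_
    -- the projection to `Tᗮ` vanishes on the range, so its derivative along `M` is zero
    have h0 : ∀ w, (Tᗮ).starProjection (fderiv ℝ φ u w) = 0 := fun w => by
      rw [Submodule.starProjection_apply_eq_zero_iff]
      exact Submodule.le_orthogonal_orthogonal T ⟨w, rfl⟩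
    have h1 := (h.hasFDerivWithinAt_zero hu h0).unique_on
      ((Tᗮ).starProjection.hasFDerivWithinAt) hv
    have h2 : (Tᗮ).starProjection v = 0 := h1.symm
    rw [Submodule.starProjection_apply_eq_zero_iff, Submodule.orthogonal_orthogonal] at h2
    exact h2
  · rintro _ ⟨v, rfl⟩
    refine Submodule.subset_span ?_
    have h1 := (h.hasFDerivAt hu).hasFDerivWithinAt (s := U) |>.mapsTo_tangent_cone
    rw [tangentConeAt_of_mem_nhds (h.isOpen_source.mem_nhds hu)] at h1
    have h2 := h1 (Set.mem_univ v)
    rw [h.bijOn.image_eq] at h2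
    exact tangentConeAt_mono Set.inter_subset_left h2

theorem hasFDerivAt_comp (h : IsParametrization M W U φ ψ) (hf : DifferentiableOn ℝ f M)
    {u : EuclideanSpace ℝ (Fin n)} (hu : u ∈ U) :
    HasFDerivAt (f ∘ φ) ((fderivWithin ℝ f M (φ u)).comp (fderiv ℝ φ u)) u := by
  have h1 := (hf _ (h.mem hu)).hasFDerivWithinAt.comp u
    ((h.hasFDerivAt hu).hasFDerivWithinAt (s := U)) (fun v hv => h.mem hv)
  exact h1.hasFDerivAt (h.isOpen_source.mem_nhds hu)

end IsParametrization

/-- For a map between spaces of equal dimension, the transpose has the same volume distortion. -/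
theorem normDet_adjoint_of_finrank_eq {E F : Type*} [NormedAddCommGroup E] [InnerProductSpace ℝ E]
    [FiniteDimensional ℝ E] [NormedAddCommGroup F] [InnerProductSpace ℝ F] [FiniteDimensional ℝ F]
    (h : Module.finrank ℝ E = Module.finrank ℝ F) (L : E →ₗ[ℝ] F) :
    L.adjoint.normDet = L.normDet := by
  have bE := (stdOrthonormalBasis ℝ E).reindex (finCongr h)
  have bF := stdOrthonormalBasis ℝ F
  rw [LinearMap.normDet_eq_norm_det_toMatrix _ bF bE,
    LinearMap.normDet_eq_norm_det_toMatrix _ bE bF,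
    LinearMap.toMatrix_adjoint, Matrix.det_conjTranspose, norm_star]

namespace IsParametrization

variable {M W : Set (EuclideanSpace ℝ (Fin d))} {U : Set (EuclideanSpace ℝ (Fin n))}
  {φ : EuclideanSpace ℝ (Fin n) → EuclideanSpace ℝ (Fin d)}
  {ψ : EuclideanSpace ℝ (Fin d) → EuclideanSpace ℝ (Fin n)}
  {f : EuclideanSpace ℝ (Fin d) → EuclideanSpace ℝ (Fin n)}

theorem finrank_tangentSubspace (h : IsParametrization M W U φ ψ)
    {u : EuclideanSpace ℝ (Fin n)} (hu : u ∈ U) :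
    Module.finrank ℝ (tangentSubspace M (φ u)) = n := by
  rw [h.tangentSubspace_eq hu, LinearMap.finrank_range_of_inj (h.injective_fderiv u hu)]
  simp

theorem sqrt_jacobianGramDet (h : IsParametrization M W U φ ψ)
    {u : EuclideanSpace ℝ (Fin n)} (hu : u ∈ U) :
    √(jacobianGramDet M f (φ u)) = (manifoldJacobian M f (φ u)).normDet := by
  have h1 := (manifoldJacobian M f (φ u)).adjoint.normDet_sq
  rw [LinearMap.adjoint_adjoint] at h1
  have h2 : jacobianGramDet M f (φ u) = (manifoldJacobian M f (φ u)).adjoint.normDet ^ 2 := h1.symm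
  rw [h2, Real.sqrt_sq (LinearMap.normDet_nonneg _), normDet_adjoint_of_finrank_eq]
  simp [h.finrank_tangentSubspace hu]

/-- The chain rule for volume distortions. -/
theorem abs_det_fderiv_comp (h : IsParametrization M W U φ ψ) (hf : DifferentiableOn ℝ f M)
    {u : EuclideanSpace ℝ (Fin n)} (hu : u ∈ U) :
    |(fderiv ℝ (f ∘ φ) u).det| =
      √(jacobianGramDet M f (φ u)) * (fderiv ℝ φ u).toLinearMap.normDet := by
  have hmem : ∀ v, (fderiv ℝ φ u).toLinearMap v ∈ tangentSubspace M (φ u) :=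
    fun v => by rw [h.tangentSubspace_eq hu]; exact ⟨v, rfl⟩
  rw [h.sqrt_jacobianGramDet hu, ← LinearMap.normDet_codRestrict hmem,
    ← LinearMap.normDet_comp_of_finrank_eq _ _ (by simp [h.finrank_tangentSubspace hu]),
    (h.hasFDerivAt_comp hf hu).fderiv, ContinuousLinearMap.det, ← LinearMap.normDet_eq_abs_det]
  rfl

theorem injective_fderiv_comp (h : IsParametrization M W U φ ψ) (hf : DifferentiableOn ℝ f M)
    (hJ : ∀ x ∈ M, 0 < jacobianGramDet M f x) {u : EuclideanSpace ℝ (Fin n)} (hu : u ∈ U) :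
    Function.Injective (fderiv ℝ (f ∘ φ) u) := by
  suffices h0 : (fderiv ℝ (f ∘ φ) u).det ≠ 0 by
    have hker : (fderiv ℝ (f ∘ φ) u).toLinearMap.ker = ⊥ := by
      contrapose! h0
      exact LinearMap.det_eq_zero_iff_ker_ne_bot.2 h0
    exact LinearMap.ker_eq_bot.1 hker
  rw [← abs_ne_zero, h.abs_det_fderiv_comp hf hu]
  refine mul_ne_zero (Real.sqrt_ne_zero'.2 (hJ _ (h.mem hu))) ?_
  exact (LinearMap.normDet_ne_zero_tfae _ |>.out 0 1).2
    (LinearMap.ker_eq_bot.2 (h.injective_fderiv u hu))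

end IsParametrization

end Chart

/-! ### Covering a submanifold by pieces on which the map is injective -/

section Pieces

open scoped Topology

variable {d n : ℕ}

theorem ContinuousOn.measurableSet_inter_preimage {X Y : Type*} [TopologicalSpace X]
    [MeasurableSpace X] [OpensMeasurableSpace X] [TopologicalSpace Y] [MeasurableSpace Y]
    [BorelSpace Y] {g : X → Y} {A : Set X} (hg : ContinuousOn g A) (hA : MeasurableSet A)
    {s : Set Y} (hs : MeasurableSet s) : MeasurableSet (A ∩ g ⁻¹' s) := by
  have h1 : Measurable (A.domRestrict g) :=
    (continuousOn_iff_continuous_domRestrict.1 hg).measurable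
  have h2 := hA.subtype_image (h1 hs)
  convert h2 using 1
  ext x
  simp [Set.domRestrict, and_comm]

/-- A differentiable map with injective derivatives is injective on each of countably many closed
sets covering its domain. -/
theorem exists_closed_cover_injOn_of_hasFDerivAt {E F : Type*} [NormedAddCommGroup E]
    [NormedSpace ℝ E] [FiniteDimensional ℝ E] [NormedAddCommGroup F] [NormedSpace ℝ F]
    [SecondCountableTopology F] {g : E → F} {g' : E → E →L[ℝ] F} {U : Set E}
    (hg : ∀ u ∈ U, HasFDerivAt g (g' u) u) (hinj : ∀ u ∈ U, Function.Injective (g' u)) :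
    ∃ t : ℕ → Set E, (∀ i, IsClosed (t i)) ∧ U ⊆ ⋃ i, t i ∧ ∀ i, Set.InjOn g (U ∩ t i) := by
  rcases U.eq_empty_or_nonempty with rfl | hU
  · exact ⟨fun _ => ∅, by simp, by simp, by simp⟩
  have hr : ∀ L : E →L[ℝ] F, ∃ r : NNReal, r ≠ 0 ∧
      (Function.Injective L → ∀ v, ‖L v‖ ≤ r * ‖v‖ → v = 0) := by
    intro L
    by_cases hL : Function.Injective L
    · obtain ⟨K, hK, hKL⟩ := L.toLinearMap.exists_antilipschitzWith (LinearMap.ker_eq_bot.2 hL)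
      refine ⟨K⁻¹ / 2, by positivity, fun _ v hv => ?_⟩
      have h1 := hKL.le_mul_dist v 0
      simp only [dist_zero_right, map_zero] at h1
      have hK' : (0 : ℝ) < K := by exact_mod_cast hK
      have h2 : ‖v‖ ≤ K * (((K : ℝ)⁻¹ / 2) * ‖v‖) := h1.trans (by
        gcongr
        simpa using hv)
      have h3 : (K : ℝ) * (((K : ℝ)⁻¹ / 2) * ‖v‖) = ‖v‖ / 2 := by field_simp
      rw [h3] at h2
      exact norm_le_zero_iff.1 (by linarith)
    · exact ⟨1, one_ne_zero, fun h => absurd h hL⟩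
  choose r hr0 hr using hr
  obtain ⟨t, L, ht, hUt, happ, hL⟩ := exists_closed_cover_approximatesLinearOn_of_hasFDerivWithinAt
    g U g' (fun u hu => (hg u hu).hasFDerivWithinAt) r hr0
  refine ⟨t, ht, hUt, fun i x hx y hy hxy => ?_⟩
  obtain ⟨u, hu, hLu⟩ := hL hU i
  have h1 := happ i x hx y hy
  rw [hxy, sub_self, zero_sub, norm_neg] at h1
  exact sub_eq_zero.1 (hr (L i) (hLu ▸ hinj u hu) _ h1)

namespace IsParametrization

variable {M W : Set (EuclideanSpace ℝ (Fin d))} {U : Set (EuclideanSpace ℝ (Fin n))}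
  {φ : EuclideanSpace ℝ (Fin n) → EuclideanSpace ℝ (Fin d)}
  {ψ : EuclideanSpace ℝ (Fin d) → EuclideanSpace ℝ (Fin n)}
  {f : EuclideanSpace ℝ (Fin d) → EuclideanSpace ℝ (Fin n)}
  {A : Set (EuclideanSpace ℝ (Fin n))}

theorem measurableSet_image (h : IsParametrization M W U φ ψ) (hA : MeasurableSet A)
    (hAU : A ⊆ U) : MeasurableSet (φ '' A) :=
  hA.image_of_continuousOn_injOn (h.contDiffOn.continuousOn.mono hAU) (h.bijOn.injOn.mono hAU)

theorem image_subset (h : IsParametrization M W U φ ψ) (hAU : A ⊆ U) : φ '' A ⊆ M ∩ W := by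
  rw [← h.bijOn.image_eq]
  exact Set.image_mono hAU

theorem measurable_normDet_fderiv (φ : EuclideanSpace ℝ (Fin n) → EuclideanSpace ℝ (Fin d)) :
    Measurable fun v => (fderiv ℝ φ v).toLinearMap.normDet :=
  continuous_normDet.measurable.comp (measurable_fderiv ℝ φ)

/-- In a chart, the volume of `M` has density `normDet (Dφ)`. -/
theorem manifoldVolume_restrict_image (h : IsParametrization M W U φ ψ) (hA : MeasurableSet A)
    (hAU : A ⊆ U) :
    (manifoldVolume n M).restrict (φ '' A) =
      ((volume.restrict A).withDensity
        fun v => ENNReal.ofReal (fderiv ℝ φ v).toLinearMap.normDet).map φ := by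
  have hφA : AEMeasurable φ (volume.restrict A) :=
    (h.contDiffOn.continuousOn.mono hAU).aemeasurable hA
  ext s hs
  have hm : MeasurableSet (A ∩ φ ⁻¹' s) :=
    (h.contDiffOn.continuousOn.mono hAU).measurableSet_inter_preimage hA hs
  have key := euclideanHausdorffMeasure_image_eq_lintegral_normDet h.isOpen_source h.contDiffOn
    h.injective_fderiv h.bijOn.injOn hm (Set.inter_subset_left.trans hAU)
  rw [finrank_euclideanSpace_fin] at key
  rw [manifoldVolume, Measure.restrict_restrict (h.measurableSet_image hA hAU),
    Set.inter_eq_left.2 ((h.image_subset hAU).trans Set.inter_subset_left),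
    Measure.restrict_apply hs, Set.inter_comm, ← Set.image_inter_preimage, key,
    Measure.map_apply_of_aemeasurable (hφA.mono_ac (withDensity_absolutelyContinuous _ _)) hs,
    withDensity_apply₀ _ (hφA.nullMeasurableSet_preimage hs),
    Measure.restrict_restrict₀ (hφA.nullMeasurableSet_preimage hs), Set.inter_comm]

theorem isAreaPiece (h : IsParametrization M W U φ ψ) (hf : DifferentiableOn ℝ f M)
    (hJ : ∀ x ∈ M, 0 < jacobianGramDet M f x) (hA : MeasurableSet A) (hAU : A ⊆ U)
    (hinj : Set.InjOn (f ∘ φ) A) :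
    IsAreaPiece (manifoldVolume n M) volume f
      (fun x => ENNReal.ofReal √(jacobianGramDet M f x)) (φ '' A) := by
  have hAM : φ '' A ⊆ M := (h.image_subset hAU).trans Set.inter_subset_left
  have hAm := h.measurableSet_image hA hAU
  have hN := measurable_normDet_fderiv φ
  have hD : Measurable fun u => |(fderiv ℝ (f ∘ φ) u).det| :=
    (ContinuousLinearMap.continuous_det.measurable.comp (measurable_fderiv ℝ (f ∘ φ))).abs
  set j : EuclideanSpace ℝ (Fin d) → ℝ≥0∞ := fun x => ENNReal.ofReal √(jacobianGramDet M f x)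
    with hj
  have hchain : ∀ u ∈ U, ENNReal.ofReal (fderiv ℝ φ u).toLinearMap.normDet * j (φ u) =
      ENNReal.ofReal |(fderiv ℝ (f ∘ φ) u).det| := fun u hu => by
    rw [h.abs_det_fderiv_comp hf hu, ENNReal.ofReal_mul (Real.sqrt_nonneg _), mul_comm]
  -- `j` in the chart as a measurable function: the tangent spaces of `M` are eliminated
  have hquot : ∀ u ∈ U, j (φ u) = ENNReal.ofReal (|(fderiv ℝ (f ∘ φ) u).det| /
      (fderiv ℝ φ u).toLinearMap.normDet) := fun u hu => by
    have h0 : (fderiv ℝ φ u).toLinearMap.normDet ≠ 0 :=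
      (LinearMap.normDet_ne_zero_tfae _ |>.out 0 1).2
        (LinearMap.ker_eq_bot.2 (h.injective_fderiv u hu))
    rw [h.abs_det_fderiv_comp hf hu, mul_div_cancel_right₀ _ h0]
  have hjφ : AEMeasurable (fun u => j (φ u)) (volume.restrict A) :=
    ((hD.div hN).ennreal_ofReal.aemeasurable).congr
      (ae_restrict_of_forall_mem hA fun u hu => (hquot u (hAU hu)).symm)
  have hjm : AEMeasurable j ((manifoldVolume n M).restrict (φ '' A)) := by
    have hψ : AEMeasurable ψ ((manifoldVolume n M).restrict (φ '' A)) :=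
      (h.continuousOn_inv.mono (h.image_subset hAU)).aemeasurable hAm
    refine ((hD.div hN).ennreal_ofReal.comp_aemeasurable hψ).congr
      (ae_restrict_of_forall_mem hAm fun x hx => ?_)
    obtain ⟨hxU, hxx⟩ := h.inv_mem (h.image_subset hAU hx)
    have := (hquot _ hxU).symm
    rwa [hxx] at this
  refine ⟨hAm, hinj.image_of_comp, hjm, fun x hx => ?_, fun x _ => ENNReal.ofReal_ne_top, ?_⟩
  · simpa [hj, Real.sqrt_pos] using hJ x (hAM hx)
  · have hφA : AEMeasurable φ (volume.restrict A) :=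
      (h.contDiffOn.continuousOn.mono hAU).aemeasurable hA
    have hfA : AEMeasurable f ((manifoldVolume n M).restrict (φ '' A)) :=
      (hf.continuousOn.mono hAM).aemeasurable hAm
    have hvol := h.manifoldVolume_restrict_image hA hAU
    have hac := withDensity_absolutelyContinuous (volume.restrict A)
        fun v => ENNReal.ofReal (fderiv ℝ φ v).toLinearMap.normDet
    have h1 : ((manifoldVolume n M).restrict (φ '' A)).withDensity j =
        ((volume.restrict A).withDensity
          fun u => ENNReal.ofReal |(fderiv ℝ (f ∘ φ) u).det|).map φ := by
      rw [hvol] at hjm ⊢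
      rw [← map_withDensity_comp (hφA.mono_ac hac) hjm,
        ← withDensity_mul₀ hN.ennreal_ofReal.aemeasurable hjφ]
      congr 1
      exact withDensity_congr_ae (ae_restrict_of_forall_mem hA fun u hu => hchain u (hAU hu))
    have hf' := hfA.mono_ac (withDensity_absolutelyContinuous _ j)
    rw [h1] at hf' ⊢
    rw [AEMeasurable.map_map_of_aemeasurable hf'
      (hφA.mono_ac (withDensity_absolutelyContinuous _ _)),
      map_withDensity_abs_det_fderiv_eq_addHaar volume hA.nullMeasurableSet
        (fun u hu =>
          (h.hasFDerivAt_comp hf (hAU hu)).differentiableAt.hasFDerivAt.hasFDerivWithinAt)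
        hinj, Set.image_comp]

end IsParametrization

theorem IsEmbeddedSubmanifold.exists_countable_isAreaPiece {M : Set (EuclideanSpace ℝ (Fin d))}
    (hM : IsEmbeddedSubmanifold n M) {f : EuclideanSpace ℝ (Fin d) → EuclideanSpace ℝ (Fin n)}
    (hf : DifferentiableOn ℝ f M) (hJ : ∀ x ∈ M, 0 < jacobianGramDet M f x) :
    ∃ 𝒜 : Set (Set (EuclideanSpace ℝ (Fin d))), 𝒜.Countable ∧ ⋃₀ 𝒜 = M ∧
      ∀ A ∈ 𝒜, IsAreaPiece (manifoldVolume n M) volume f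
        (fun x => ENNReal.ofReal √(jacobianGramDet M f x)) A := by
  have hloc : ∀ x : M, ∃ (W : Set (EuclideanSpace ℝ (Fin d)))
      (A : ℕ → Set (EuclideanSpace ℝ (Fin d))), IsOpen W ∧ (x : EuclideanSpace ℝ (Fin d)) ∈ W ∧
      ⋃ i, A i = M ∩ W ∧ ∀ i, IsAreaPiece (manifoldVolume n M) volume f
        (fun x => ENNReal.ofReal √(jacobianGramDet M f x)) (A i) := by
    rintro ⟨x, hx⟩
    obtain ⟨W, U, φ, ψ, hxW, h⟩ := hM.exists_isParametrization hx
    obtain ⟨t, ht, hUt, hinj⟩ := exists_closed_cover_injOn_of_hasFDerivAt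
      (fun u hu => (h.hasFDerivAt_comp hf hu).differentiableAt.hasFDerivAt)
      (fun u hu => h.injective_fderiv_comp hf hJ hu)
    refine ⟨W, fun i => φ '' (U ∩ t i), h.isOpen_target, hxW, ?_, fun i => ?_⟩
    · rw [← Set.image_iUnion, ← Set.inter_iUnion, Set.inter_eq_left.2 hUt, h.bijOn.image_eq]
    · exact h.isAreaPiece hf hJ (h.isOpen_source.measurableSet.inter (ht i).measurableSet)
        Set.inter_subset_left (hinj i)
  choose W A hW hxW hA hpiece using hloc
  obtain ⟨T, hT, hTW⟩ := TopologicalSpace.isOpen_iUnion_countable W hW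
  refine ⟨⋃ x ∈ T, Set.range (A x), hT.biUnion fun x _ => Set.countable_range _, ?_, ?_⟩
  · apply Set.Subset.antisymm
    · rintro y ⟨B, hB, hyB⟩
      obtain ⟨x, -, i, rfl⟩ := Set.mem_iUnion₂.1 hB
      exact (hA x ▸ Set.mem_iUnion.2 ⟨i, hyB⟩ : y ∈ M ∩ W x).1
    · intro y hy
      have h1 : y ∈ ⋃ x ∈ T, W x := hTW ▸ Set.mem_iUnion.2 ⟨⟨y, hy⟩, hxW _⟩
      obtain ⟨x, hx, hyx⟩ := Set.mem_iUnion₂.1 h1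
      have h2 : y ∈ ⋃ i, A x i := hA x ▸ ⟨hy, hyx⟩
      obtain ⟨i, hi⟩ := Set.mem_iUnion.1 h2
      exact ⟨A x i, Set.mem_iUnion₂.2 ⟨x, hx, i, rfl⟩, hi⟩
  · intro B hB
    obtain ⟨x, -, i, rfl⟩ := Set.mem_iUnion₂.1 hB
    exact hpiece x i

end Pieces

/-! ### Openness of differentiable maps with invertible derivatives -/

section OpenMap

open scoped Topology

/-- A map which is differentiable, but perhaps not continuously so, with invertible derivatives is
open: a point `z` close to `g u` is attained where `‖g - z‖²` is minimal on a small ball. -/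
theorem image_mem_nhds_of_injective_fderiv {E : Type*} [NormedAddCommGroup E]
    [InnerProductSpace ℝ E] [FiniteDimensional ℝ E] {g : E → E} {g' : E → E →L[ℝ] E} {U : Set E}
    (hg : ∀ u ∈ U, HasFDerivAt g (g' u) u) (hinj : ∀ u ∈ U, Function.Injective (g' u)) {u : E}
    (hU : U ∈ 𝓝 u) : g '' U ∈ 𝓝 (g u) := by
  have hne : ∀ᶠ v in 𝓝[≠] u, g v ≠ g u := by
    obtain ⟨K, -, hK⟩ := (g' u).toLinearMap.exists_antilipschitzWith
      (LinearMap.ker_eq_bot.2 (hinj u (mem_of_mem_nhds hU)))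
    exact (hg u (mem_of_mem_nhds hU)).eventually_ne ⟨K, hK⟩
  rw [eventually_nhdsWithin_iff] at hne
  obtain ⟨r, hr, hball⟩ := Metric.nhds_basis_closedBall.mem_iff.1 (Filter.inter_mem hU hne)
  have hcont : ContinuousOn g (Metric.closedBall u r) := fun v hv =>
    (hg v (hball hv).1).continuousAt.continuousWithinAt
  -- a positive lower bound for the distance from `g u` on the sphere
  obtain ⟨m, hm, hsphere⟩ : ∃ m > 0, ∀ v ∈ Metric.sphere u r, m ≤ dist (g v) (g u) := by
    rcases (Metric.sphere u r).eq_empty_or_nonempty with he | hn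
    · exact ⟨1, one_pos, by simp [he]⟩
    · obtain ⟨v, hv, hmin⟩ := (isCompact_sphere u r).exists_isMinOn hn
        (f := fun v => dist (g v) (g u))
        ((continuous_id.dist continuous_const).comp_continuousOn
          (hcont.mono Metric.sphere_subset_closedBall))
      refine ⟨dist (g v) (g u), dist_pos.2 ?_, fun w hw => hmin hw⟩
      exact (hball (Metric.sphere_subset_closedBall hv)).2 (Metric.ne_of_mem_sphere hv hr.ne')
  refine Filter.mem_of_superset (Metric.ball_mem_nhds (g u) (half_pos hm)) fun z hz => ?_
  obtain ⟨v, hv, hmin⟩ := (isCompact_closedBall u r).exists_isMinOn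
    ⟨u, Metric.mem_closedBall_self hr.le⟩
    (f := fun v => ‖g v - z‖ ^ 2) ((hcont.sub continuousOn_const).norm.pow 2)
  have hvu : ‖g v - z‖ ≤ ‖g u - z‖ := by
    have : ‖g v - z‖ ^ 2 ≤ ‖g u - z‖ ^ 2 := hmin (Metric.mem_closedBall_self hr.le)
    exact (sq_le_sq₀ (norm_nonneg _) (norm_nonneg _)).1 this
  have hvb : v ∈ Metric.ball u r := by
    refine lt_of_le_of_ne (Metric.mem_closedBall.1 hv) fun he => ?_
    have h1 := hsphere v he
    have h2 := dist_triangle (g v) z (g u)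
    rw [Metric.mem_ball] at hz
    rw [← dist_eq_norm, ← dist_eq_norm, dist_comm (g u)] at hvu
    linarith
  have hloc : IsLocalMin (fun v => ‖g v - z‖ ^ 2) v :=
    hmin.isLocalMin (Filter.mem_of_superset (Metric.isOpen_ball.mem_nhds hvb)
      Metric.ball_subset_closedBall)
  have hder := hloc.hasFDerivAt_eq_zero ((hg v (hball hv).1).sub_const z).norm_sq
  have hsurj : Function.Surjective (g' v) :=
    (LinearMap.injective_iff_surjective (f := (g' v).toLinearMap)).1 (hinj v (hball hv).1)
  obtain ⟨w, hw⟩ := hsurj (g v - z)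
  have h0 := congrArg (fun L : E →L[ℝ] ℝ => L w) hder
  simp only [FunLike.coe_smul, Pi.smul_apply, ContinuousLinearMap.comp_apply, innerSL_apply_apply,
    hw, real_inner_self_eq_norm_sq] at h0
  refine ⟨v, (hball hv).1, sub_eq_zero.1 ?_⟩
  simpa using h0

end OpenMap

/-! ### Openness and injectivity along the submanifold -/

section Submanifold

open scoped Topology

variable {d n : ℕ} {M : Set (EuclideanSpace ℝ (Fin d))}
  {f : EuclideanSpace ℝ (Fin d) → EuclideanSpace ℝ (Fin n)}

/-- A non-singular differentiable map is open along the submanifold. -/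
theorem IsEmbeddedSubmanifold.image_inter_mem_nhds (hM : IsEmbeddedSubmanifold n M)
    (hf : DifferentiableOn ℝ f M) (hJ : ∀ x ∈ M, 0 < jacobianGramDet M f x)
    {x : EuclideanSpace ℝ (Fin d)} (hx : x ∈ M) {O : Set (EuclideanSpace ℝ (Fin d))}
    (hO : O ∈ 𝓝 x) : f '' (M ∩ O) ∈ 𝓝 (f x) := by
  obtain ⟨W, U, φ, ψ, hxW, h⟩ := hM.exists_isParametrization hx
  obtain ⟨hu, hux⟩ := h.inv_mem ⟨hx, hxW⟩
  have hV : U ∩ φ ⁻¹' O ∈ 𝓝 (ψ x) := Filter.inter_mem (h.isOpen_source.mem_nhds hu)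
    ((h.hasFDerivAt hu).continuousAt.preimage_mem_nhds (by rwa [hux]))
  have h1 := image_mem_nhds_of_injective_fderiv (g := f ∘ φ)
    (fun u hu => (h.hasFDerivAt_comp hf hu.1).differentiableAt.hasFDerivAt)
    (fun u hu => h.injective_fderiv_comp hf hJ hu.1) hV
  rw [Function.comp_apply, hux] at h1
  refine Filter.mem_of_superset h1 ?_
  rintro _ ⟨u, hu, rfl⟩
  exact ⟨φ u, ⟨h.mem hu.1, hu.2⟩, rfl⟩

/-- If two points of `M` had the same image, their neighbourhoods would have images overlapping in a
set of positive volume, which cannot be avoided by removing a null set. -/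
theorem IsEmbeddedSubmanifold.injOn_of_injOn_conull (hM : IsEmbeddedSubmanifold n M)
    (hf : DifferentiableOn ℝ f M) (hJ : ∀ x ∈ M, 0 < jacobianGramDet M f x)
    {S : Set (EuclideanSpace ℝ (Fin d))} (hnull : volume (f '' (M ∩ Sᶜ)) = 0)
    (hinj : Set.InjOn f S) : Set.InjOn f M := by
  intro x hx y hy hxy
  by_contra hne
  obtain ⟨O, O', hO, hO', hxO, hyO, hdisj⟩ := t2_separation hne
  have h1 := hM.image_inter_mem_nhds hf hJ hx (hO.mem_nhds hxO)
  have h2 := hM.image_inter_mem_nhds hf hJ hy (hO'.mem_nhds hyO)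
  rw [← hxy] at h2
  have hpos := Measure.measure_pos_of_mem_nhds volume (Filter.inter_mem h1 h2)
  rw [← measure_sdiff_null hnull] at hpos
  obtain ⟨z, ⟨⟨a, ha, haz⟩, ⟨b, hb, hbz⟩⟩, hz⟩ := nonempty_of_measure_ne_zero hpos.ne'
  have haS : a ∈ S := by
    by_contra h
    exact hz ⟨a, ⟨ha.1, h⟩, haz⟩
  have hbS : b ∈ S := by
    by_contra h
    exact hz ⟨b, ⟨hb.1, h⟩, hbz⟩
  have hab : a = b := hinj haS hbS (haz.trans hbz.symm)
  exact Set.disjoint_left.1 hdisj ha.2 (hab ▸ hb.2)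

theorem foldingEntropy_congr {P : Measure (EuclideanSpace ℝ (Fin d))} [IsProbabilityMeasure P]
    {g : EuclideanSpace ℝ (Fin d) → EuclideanSpace ℝ (Fin n)} (h : f =ᵐ[P] g) :
    foldingEntropy P f = foldingEntropy P g := by
  unfold foldingEntropy
  rw [condDistrib_congr_right h]
  exact lintegral_congr_ae (h.mono fun x hx => by simp only [hx])

end Submanifold

theorem mainTheorem4 {d n : ℕ} (M : Set (EuclideanSpace ℝ (Fin d)))
    (hM : IsEmbeddedSubmanifold n M)
    (P : Measure (EuclideanSpace ℝ (Fin d))) [IsProbabilityMeasure P]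
    (hP : P ≪ manifoldVolume n M)
    (f : EuclideanSpace ℝ (Fin d) → EuclideanSpace ℝ (Fin n))
    (hf : DifferentiableOn ℝ f M)
    (hJ : ∀ x ∈ M, 0 < jacobianGramDet M f x) :
    -- the pushforward has a density on `ℝⁿ`
    P.map f ≪ volume ∧
    -- the entropy decomposition, whenever its right-hand side makes sense in `[-∞, ∞]`
    (∀ h j : EReal,
      HasDifferentialEntropy P (manifoldVolume n M) h →
      HasMean P (fun x => ((1 / 2 * Real.log (jacobianGramDet M f x) : ℝ) : EReal)) j →
      ((h ≠ ⊤ ∧ j ≠ ⊤) ∨ (h ≠ ⊥ ∧ j ≠ ⊥ ∧ foldingEntropy P f ≠ ∞)) →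
      HasDifferentialEntropy (P.map f) volume (h + j - (foldingEntropy P f : EReal))) ∧
    -- the folding entropy vanishes exactly when `f` is injective up to a `P`-null set
    (foldingEntropy P f = 0 ↔
      ∃ S : Set (EuclideanSpace ℝ (Fin d)), P Sᶜ = 0 ∧ Set.InjOn f S) ∧
    -- in particular it vanishes when `f` is injective on the support of `P`
    (Set.InjOn f (M ∩ P.support) → foldingEntropy P f = 0) ∧
    -- if the density of `P` is positive almost everywhere on `M`, exactly when `f` is injective
    (manifoldVolume n M ≪ P → (foldingEntropy P f = 0 ↔ Set.InjOn f M)) := by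
  classical
  obtain ⟨𝒜, h𝒜, hcov, hpiece⟩ := hM.exists_countable_isAreaPiece hf hJ
  have hMm : MeasurableSet M :=
    hcov ▸ MeasurableSet.sUnion h𝒜 fun A hA => (hpiece A hA).measurableSet
  have hνM : manifoldVolume n M Mᶜ = 0 := by
    rw [manifoldVolume, Measure.restrict_apply hMm.compl, Set.compl_inter_self, measure_empty]
  have hPM : P Mᶜ = 0 := hP hνM
  -- `f` is only constrained on `M`; replace it by a measurable map which agrees with it there
  set g : EuclideanSpace ℝ (Fin d) → EuclideanSpace ℝ (Fin n) := M.piecewise f 0 with hg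
  have hgm : Measurable g := hf.continuousOn.measurable_piecewise continuousOn_const hMm
  have hfg : Set.EqOn f g M := fun x hx => (Set.piecewise_eq_of_mem M f 0 hx).symm
  have hfgP : f =ᵐ[P] g := by
    filter_upwards [show ∀ᵐ x ∂P, x ∈ M from hPM] with x hx using hfg hx
  have : Countable 𝒜 := h𝒜.to_subtype
  have hpiece' : ∀ A : 𝒜, IsAreaPiece (manifoldVolume n M) volume g
      (fun x => ENNReal.ofReal √(jacobianGramDet M f x)) A := fun A =>
    (hpiece A A.2).congr (hfg.mono (hcov ▸ Set.subset_sUnion_of_mem A.2))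
  have hcov' : manifoldVolume n M (⋃ A : 𝒜, (A : Set (EuclideanSpace ℝ (Fin d))))ᶜ = 0 := by
    rw [← Set.sUnion_eq_iUnion, hcov, hνM]
  have hzero : foldingEntropy P f = 0 ↔
      ∃ S : Set (EuclideanSpace ℝ (Fin d)), P Sᶜ = 0 ∧ Set.InjOn f S := by
    rw [foldingEntropy_congr hfgP, foldingEntropy, lintegral_neg_log_condDistrib_eq_zero_iff hgm,
      ae_condDistrib_singleton_eq_one_iff hgm]
    have hinter : ∀ S : Set (EuclideanSpace ℝ (Fin d)), P Sᶜ = 0 → P (S ∩ M)ᶜ = 0 := fun S hS => by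
      rw [Set.compl_inter]
      exact measure_union_null hS hPM
    constructor
    · rintro ⟨S, hS, hinj⟩
      exact ⟨S ∩ M, hinter S hS, (hinj.mono Set.inter_subset_left).congr
        (hfg.symm.mono Set.inter_subset_right)⟩
    · rintro ⟨S, hS, hinj⟩
      exact ⟨S ∩ M, hinter S hS, (hinj.mono Set.inter_subset_left).congr
        (hfg.mono Set.inter_subset_right)⟩
  refine ⟨?_, fun h j hh hj hdef => ?_, hzero, fun hinj => ?_, fun hac => ?_⟩
  · rw [Measure.map_congr hfgP]
    exact map_absolutelyContinuous_of_isAreaPiece hgm hpiece' hcov' hP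
  · rw [foldingEntropy_congr hfgP] at hdef ⊢
    rw [Measure.map_congr hfgP]
    refine hasDifferentialEntropy_map_of_isAreaPiece hgm hpiece' hcov' hh (hj.congr ?_) hdef
    filter_upwards [show ∀ᵐ x ∂P, x ∈ M from hPM] with x hx
    rw [ENNReal.log_ofReal_of_pos (Real.sqrt_pos.2 (hJ x hx)), Real.log_sqrt (hJ x hx).le]
    congr 1
    ring
  · -- both `M` and the support of `P` carry all of `P`
    refine hzero.2 ⟨M ∩ P.support, ?_, hinj⟩
    rw [Set.compl_inter]
    exact measure_union_null hPM Measure.measure_compl_support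
  · refine hzero.trans ⟨?_, fun hinj => ⟨M, hPM, hinj⟩⟩
    rintro ⟨S, hS, hinj⟩
    refine hM.injOn_of_injOn_conull hf hJ ?_ hinj
    have hI : f '' (M ∩ Sᶜ) = ⋃ A : 𝒜, g '' ((A : Set (EuclideanSpace ℝ (Fin d))) ∩ Sᶜ) := by
      rw [(hfg.mono Set.inter_subset_left).image_eq, ← Set.image_iUnion, ← Set.iUnion_inter,
        ← Set.sUnion_eq_iUnion, hcov]
    rw [hI]
    exact measure_iUnion_null fun A => (hpiece' A).measure_image_inter_eq_zero hgm (hac hS)
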